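/- Let $c\ge 0$ and $T>0$ be constants. Let $a:\mathbb R\to\mathbb R$ be a $1$-periodic $C^2$ function with $a(x)\ge a_0>0$ for all $x$, let $\alpha:\mathbb R\to\mathbb C$ be a $1$-periodic $C^2$ function, and let $r:\mathbb C\to\mathbb C$ be twice differentiable (in the real sense, $\mathbb C\simeq\mathbb R^2$) with bounded first and second derivatives. For $2\pi$-periodic $g$ put $\Pi g=\frac1{2\pi}\int_0^{2\pi}g(\tau)\,d\tau$, and for $g$ with $\Pi g=0$ put $(\mathcal L^{-1}g)(\tau)=(I-\Pi)\int_0^\tau g(\sigma)\,d\sigma$; let $$G(\tau,z)=\mathcal L^{-1}(I-\Pi)\big[e^{-i\tau}r(e^{i\tau}z)\big],\qquad V_{\rm in}^{\varepsilon}(x,\tau)=\alpha(x)+\frac{\varepsilon}{a(x)}\big[G(0,\alpha(x))-G(\tau,\alpha(x))\big].$$ For $\varepsilon\in(0,1]$ let $V=V(t,x,\tau)$ be the classical ($C^1$) solution on $[0,T]$, $1$-periodic in $x$ and $2\pi$-periodic in $\tau$, of $$\partial_tV+c\,\partial_xV+e^{-i\tau}r(e^{i\tau}V)=-\frac{a(x)}{\varepsilon}\,\partial_\tau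 V,\qquad V(0,x,\tau)=V_{\rm in}^{\varepsilon}(x,\tau).$$ Let $N,N_x\ge1$ be integers, $\Delta t=T/N$, $\Delta x=1/N_x$, $t_n=n\Delta t$, $x_j=j\Delta x$, and consider the scheme, whose unknowns $V_j^n=V_j^n(\tau)$ are $C^1$, $2\pi$-periodic in $\tau$ and satisfy $V^n_{j+N_x}=V^n_j$: $$\frac{V_j^{n+1}-V_j^n}{\Delta t}+c\,\frac{V_j^n-V_{j-1}^n}{\Delta x}+e^{-i\tau}r(e^{i\tau}V_j^n)=-\frac{a(x_j)}{\varepsilon}\,\partial_\tau V_j^{n+1},\qquad V_j^0(\tau)=V_{\rm in}^{\varepsilon}(x_j,\tau).$$ This scheme is well defined: for all $\varepsilon\in(0,1]$ and all step sizes it has exactly one solution $(V_j^n)$. Moreover there is a constant $C>0$, independent of $\varepsilon$, $\Delta t$ and $\Delta x$, such that whenever the CFL condition $c\,\Delta t/\Delta x<1$ holds, $$\sup_{\varepsilon\in(0,1]}\big\|V(t_n,x_j)-V_j^n\big\|_{L^\infty_\tau}\le C(\Delta t+\Delta x)\qquad\text{for all } n=0,\dots,N \text{ and all } j=0,\dots,N_x.$$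 -/

import Mathlib

namespace TwoScale

noncomputable section

/-- The average `Π g = (1 / 2π) ∫₀^{2π} g(τ) dτ` of a `2π`-periodic function. -/
def average (g : ℝ → ℂ) : ℂ :=
  (1 / (2 * Real.pi) : ℂ) * ∫ σ in (0 : ℝ)..(2 * Real.pi), g σ

/-- The inverse of `∂_τ` on functions of zero average, with values of zero average:
`(L⁻¹ g)(τ) = (I - Π) ∫₀^τ g(σ) dσ`. -/
def primitive (g : ℝ → ℂ) (τ : ℝ) : ℂ :=
  (∫ σ in (0 : ℝ)..τ, g σ) - average (fun s => ∫ σ in (0 : ℝ)..s, g σ)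

/-- The source term `e^{-iτ} r(e^{iτ} z)` seen by the profile. -/
def source (r : ℂ → ℂ) (τ : ℝ) (z : ℂ) : ℂ :=
  Complex.exp (-(Complex.I * τ)) * r (Complex.exp (Complex.I * τ) * z)

/-- `G(τ, z) = L⁻¹ (I - Π) [e^{-iτ} r(e^{iτ} z)]`. -/
def corrector (r : ℂ → ℂ) (τ : ℝ) (z : ℂ) : ℂ :=
  primitive (fun σ => source r σ z - average (fun s => source r s z)) τ

/-- The well-prepared initial data
`α(x) + (ε / a(x)) (G(0, α(x)) - G(τ, α(x)))`. -/
def initialData (r : ℂ → ℂ) (a : ℝ → ℝ) (α : ℝ → ℂ) (ε x τ : ℝ) : ℂ :=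
  α x + ((ε / a x : ℝ) : ℂ) * (corrector r 0 (α x) - corrector r τ (α x))

/-- `V(t, x, τ)` is a classical (`C¹`) solution on `[0, T]` of
`∂_t V + c ∂_x V + e^{-iτ} r(e^{iτ} V) = -(a(x) / ε) ∂_τ V`,
`1`-periodic in `x` and `2π`-periodic in `τ`, with the well-prepared initial data.
Only the values of `V` for `t ∈ [0, T]` matter. -/
structure IsSolution (r : ℂ → ℂ) (a : ℝ → ℝ) (α : ℝ → ℂ) (c T ε : ℝ)
    (V : ℝ → ℝ → ℝ → ℂ) : Prop where
  contDiffOn : ContDiffOn ℝ 1 (fun p : ℝ × ℝ × ℝ => V p.1 p.2.1 p.2.2)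
    (Set.Icc 0 T ×ˢ Set.univ)
  periodic_x : ∀ t ∈ Set.Icc 0 T, ∀ x τ, V t (x + 1) τ = V t x τ
  periodic_tau : ∀ t ∈ Set.Icc 0 T, ∀ x τ, V t x (τ + 2 * Real.pi) = V t x τ
  initial : ∀ x τ, V 0 x τ = initialData r a α ε x τ
  equation : ∀ t ∈ Set.Icc 0 T, ∀ x τ,
    derivWithin (fun s => V s x τ) (Set.Icc 0 T) t
        + (c : ℂ) * deriv (fun y => V t y τ) x
        + source r τ (V t x τ)
      = -((a x / ε : ℝ) : ℂ) * deriv (fun θ => V t x θ) τ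

/-- `v n j τ` is a solution of the scheme with time step `Δt` and space step `Δx = 1 / M`:
upwind in `x`, implicit in the stiff term, `τ` continuous. The space index `j` ranges over `ℤ`,
with period `M`, which encodes the periodic boundary condition. -/
structure IsSchemeSolution (r : ℂ → ℂ) (a : ℝ → ℝ) (α : ℝ → ℂ) (c ε Δt : ℝ) (M : ℕ)
    (v : ℕ → ℤ → ℝ → ℂ) : Prop where
  contDiff : ∀ n j, ContDiff ℝ 1 (v n j)
  periodic_x : ∀ n j τ, v n (j + M) τ = v n j τ
  periodic_tau : ∀ n j τ, v n j (τ + 2 * Real.pi) = v n j τ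
  initial : ∀ j τ, v 0 j τ = initialData r a α ε (j * (1 / M)) τ
  step : ∀ n j τ,
    (v (n + 1) j τ - v n j τ) / (Δt : ℂ)
        + (c : ℂ) * ((v n j τ - v n (j - 1) τ) / ((1 / M : ℝ) : ℂ))
        + source r τ (v n j τ)
      = -((a (j * (1 / M)) / ε : ℝ) : ℂ) * deriv (v (n + 1) j) τ

end

end TwoScale

/-! The local error of the scheme involves second-order variations of `V` in `t` and `x`, which for
general data cost powers of `1/ε`. Two facts prevent this. The well-prepared datum makes the second
differences of `V` in `(t, x)`, at fixed `τ`, quadratically small uniformly in `ε`. The stiff term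
is implicit, hence exact in an expansion about the new time level, so `∂_τ V` is never differenced.

Uniform regularity. The speed `a(x)/ε` of the phase depends on `x`, so neighbouring characteristics
drift out of phase at rate `1/ε`. With `y = ∫ a` as space variable and the equation divided by `a`,
a characteristic moves at constant speeds `c` in `y` and `1/ε` in the phase. The dependence on `x`
now sits in a clock `b = 1/a` in front of `∂_t` (`exists_clock`, `IsProfile`). Points with equal
phases keep equal phases when moved back by the same parameter, so differences obey a Grönwall
inequality free of `1/ε`. The points do not reach time `0` together (`exists_common_start`). The
times left are of the order of the shift and are bridged by `W = w + t ρ + O(t ^ 2)`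
(`norm_sub_initial_le`). This is where the corrector matters: it removes `1/ε` from the initial rate
`ρ` and leaves it a phase variation of order `ε`, which is what `phaseDist` measures. The outcome is
`exists_second_difference`.

Since `V` is only `C¹` and the second derivative of `r` is only bounded, everything is phrased with
finite differences (`DiffBound`), and `norm_sub_sub_deriv_le` turns second differences back into a
Taylor estimate.

Convergence. A time step is an explicit upwind update followed by the inverse of `1 + κ ∂_τ`, which
does not increase the sup norm, whatever `κ` is (`norm_le_of_resolvent`). Under the CFL condition
the update is Lipschitz with constant `1 + K Δt`. With a local error of order `Δt (Δt + Δx)`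
(`norm_truncation_le`), a discrete Grönwall argument concludes (`norm_error_le`). -/

namespace TwoScale

open Set Filter Topology

/-! ### Elementary tools: Grönwall, finite differences, the resolvent in the phase. -/

/-- A Grönwall estimate with an explicit elementary bound. -/
theorem norm_le_of_norm_deriv_le {f f' : ℝ → ℂ} {S δ K E : ℝ} (hK : 0 ≤ K) (hE : 0 ≤ E)
    (hf : ∀ s ∈ Icc 0 S, HasDerivWithinAt f (f' s) (Icc 0 S) s) (h0 : ‖f 0‖ ≤ δ)
    (hb : ∀ s ∈ Icc 0 S, ‖f' s‖ ≤ K * ‖f s‖ + E) :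
    ∀ s ∈ Icc 0 S, ‖f s‖ ≤ (δ + E * s) * Real.exp (K * s) := by
  intro s hs
  have hc : ContinuousOn f (Icc 0 S) := fun x hx => (hf x hx).continuousWithinAt
  have h1 := norm_le_gronwallBound_of_norm_deriv_right_le hc
    (fun x hx => (hf x ⟨hx.1, hx.2.le⟩).mono_of_mem_nhdsWithin (Icc_mem_nhdsGE_of_mem hx)) h0
    (fun x hx => hb x ⟨hx.1, hx.2.le⟩) s hs
  refine h1.trans ?_
  rw [sub_zero]
  rcases hK.eq_or_lt with rfl | hK
  · simp [gronwallBound_K0]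
  · rw [gronwallBound_of_K_ne_0 hK.ne']
    have h2 : Real.exp (K * s) - 1 ≤ K * s * Real.exp (K * s) := by
      have h3 := Real.add_one_le_exp (-(K * s))
      have h4 : Real.exp (-(K * s)) * Real.exp (K * s) = 1 := by
        rw [← Real.exp_add]; simp
      nlinarith [Real.exp_pos (K * s)]
    have h5 : E / K * (Real.exp (K * s) - 1) ≤ E / K * (K * s * Real.exp (K * s)) :=
      mul_le_mul_of_nonneg_left h2 (by positivity)
    have h6 : E / K * (K * s * Real.exp (K * s)) = E * s * Real.exp (K * s) := by
      field_simp
    rw [add_mul]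
    linarith

/-- `g` is Lipschitz with constant `K` and so is its derivative, expressed by differences. -/
structure DiffBound (K : ℝ) (g : ℂ → ℂ) : Prop where
  lip : ∀ z w, ‖g z - g w‖ ≤ K * ‖z - w‖
  mixed : ∀ p p' q, ‖(g (p + q) - g p) - (g (p' + q) - g p')‖ ≤ K * ‖q‖ * ‖p - p'‖

/-- The mean value inequality for `r`, and for the increment `w ↦ r (w + q) - r w`, whose derivative
is at most `K ‖q‖` since `fderiv ℝ r` is Lipschitz. Continuity of the second derivative plays no
role. -/
theorem DiffBound.of_fderiv {r : ℂ → ℂ} {K : ℝ} (hr : Differentiable ℝ r)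
    (hr' : Differentiable ℝ (fderiv ℝ r)) (h1 : ∀ z, ‖fderiv ℝ r z‖ ≤ K)
    (h2 : ∀ z, ‖fderiv ℝ (fderiv ℝ r) z‖ ≤ K) : DiffBound K r where
  lip z w := convex_univ.norm_image_sub_le_of_norm_fderiv_le (𝕜 := ℝ) (fun x _ => hr x)
    (fun x _ => h1 x) (mem_univ w) (mem_univ z)
  mixed p p' q := by
    have hd : ∀ x, HasFDerivAt (fun w => r (w + q) - r w)
        (fderiv ℝ r (x + q) - fderiv ℝ r x) x := fun x =>
      (((hr (x + q)).hasFDerivAt.comp x ((hasFDerivAt_id x).add_const q))).sub (hr x).hasFDerivAt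
    refine convex_univ.norm_image_sub_le_of_norm_hasFDerivWithin_le (𝕜 := ℝ)
      (f := fun w => r (w + q) - r w)
      (fun x _ => (hd x).hasFDerivWithinAt) (fun x _ => ?_) (mem_univ p') (mem_univ p)
    have := convex_univ.norm_image_sub_le_of_norm_fderiv_le (𝕜 := ℝ) (fun x _ => hr' x)
      (fun x _ => h2 x) (mem_univ x) (mem_univ (x + q))
    simpa using this

/-- Replace `z₃` by the reflection of `z₁` in `z₂`. There the second difference of `g` is a mixed
difference, and the error of the replacement is controlled by the second difference of the points.
-/
theorem DiffBound.second {g : ℂ → ℂ} {K : ℝ} (hg : DiffBound K g) (z₁ z₂ z₃ : ℂ) :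
    ‖g z₁ - 2 * g z₂ + g z₃‖ ≤ K * ‖z₁ - 2 * z₂ + z₃‖ + K * ‖z₁ - z₂‖ ^ 2 := by
  have h1 := hg.mixed z₂ (z₂ - (z₁ - z₂)) (z₁ - z₂)
  have h2 := hg.lip z₃ (z₂ - (z₁ - z₂))
  have e1 : z₂ + (z₁ - z₂) = z₁ := by ring
  have e2 : z₂ - (z₁ - z₂) + (z₁ - z₂) = z₂ := by ring
  have e3 : z₂ - (z₂ - (z₁ - z₂)) = z₁ - z₂ := by ring
  have e4 : z₃ - (z₂ - (z₁ - z₂)) = z₁ - 2 * z₂ + z₃ := by ring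
  rw [e1, e2, e3] at h1
  rw [e4] at h2
  calc ‖g z₁ - 2 * g z₂ + g z₃‖
      = ‖(g z₃ - g (z₂ - (z₁ - z₂))) + ((g z₁ - g z₂) - (g z₂ - g (z₂ - (z₁ - z₂))))‖ := by
        congr 1; ring
    _ ≤ _ := (norm_add_le _ _).trans (by nlinarith)

theorem norm_exp_neg_I_mul (τ : ℝ) : ‖Complex.exp (-(Complex.I * τ))‖ = 1 := by
  rw [Complex.norm_exp]; simp

theorem norm_exp_I_mul (τ : ℝ) : ‖Complex.exp (Complex.I * τ)‖ = 1 := by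
  rw [Complex.norm_exp]; simp

/-- Multiplication by a phase is an isometry, so the constant does not depend on `τ`. -/
theorem DiffBound.source {r : ℂ → ℂ} {K : ℝ} (hr : DiffBound K r) (τ : ℝ) :
    DiffBound K (source r τ) where
  lip z w := by
    have := hr.lip (Complex.exp (Complex.I * τ) * z) (Complex.exp (Complex.I * τ) * w)
    rw [← mul_sub, norm_mul, norm_exp_I_mul, one_mul] at this
    rw [TwoScale.source, TwoScale.source, ← mul_sub, norm_mul, norm_exp_neg_I_mul, one_mul]
    exact this
  mixed p p' q := by
    have := hr.mixed (Complex.exp (Complex.I * τ) * p) (Complex.exp (Complex.I * τ) * p')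
      (Complex.exp (Complex.I * τ) * q)
    rw [← mul_sub, norm_mul, norm_mul, norm_exp_I_mul, one_mul, one_mul, ← mul_add,
      ← mul_add] at this
    simp only [TwoScale.source]
    rw [← mul_sub, ← mul_sub, ← mul_sub, norm_mul, norm_exp_neg_I_mul, one_mul]
    exact this

theorem DiffBound.norm_le {r : ℂ → ℂ} {K : ℝ} (hr : DiffBound K r) (z : ℂ) :
    ‖r z‖ ≤ ‖r 0‖ + K * ‖z‖ := by
  have := hr.lip z 0
  rw [sub_zero] at this
  have h2 := norm_add_le (r z - r 0) (r 0)
  rw [sub_add_cancel] at h2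
  linarith

theorem norm_source_zero (r : ℂ → ℂ) (τ : ℝ) : ‖source r τ 0‖ = ‖r 0‖ := by
  rw [source, norm_mul, norm_exp_neg_I_mul, one_mul, mul_zero]

/-- If the second differences of `f` based at `0` are quadratically small, then `f` is within the
same order of its first-order expansion. -/
theorem norm_sub_sub_deriv_le {f : ℝ → ℂ} {f' : ℂ} {C : ℝ}
    (hf : HasDerivWithinAt f f' (Icc 0 1) 0)
    (h : ∀ μ : ℝ, 0 ≤ μ → 2 * μ ≤ 1 → ‖f (2 * μ) - 2 * f μ + f 0‖ ≤ C * μ ^ 2) :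
    ‖f 1 - f 0 - f'‖ ≤ C / 2 := by
  set x : ℕ → ℝ := fun n => (1 / 2 : ℝ) ^ n with hx
  have hC : 0 ≤ C := by
    have := (norm_nonneg _).trans (h (1 / 2) (by norm_num) (by norm_num))
    linarith
  have hx0 : ∀ n, 0 < x n := fun n => by positivity
  have hx1 : ∀ n, x n ≤ 1 := fun n => pow_le_one₀ (by norm_num) (by norm_num)
  have hxs : ∀ n, x n = 2 * x (n + 1) := fun n => by simp only [hx, pow_succ]; ring
  set g : ℕ → ℂ := fun n => (x n)⁻¹ • (f (x n) - f 0) with hg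
  have hlim : Tendsto g atTop (𝓝 f') := by
    have h1 := hasDerivWithinAt_iff_tendsto_slope.1 hf
    have h2 : Tendsto x atTop (𝓝[Icc 0 1 \ {0}] 0) := by
      refine tendsto_nhdsWithin_iff.2 ⟨tendsto_pow_atTop_nhds_zero_of_lt_one (by norm_num)
        (by norm_num), Eventually.of_forall fun n => ⟨⟨(hx0 n).le, hx1 n⟩, (hx0 n).ne'⟩⟩
    refine (h1.comp h2).congr fun n => ?_
    simp [slope, hg]
  -- Halving the step changes the difference quotient by `(x n)⁻¹` times a second difference of step
  -- `x (n + 1)`. Telescoping, with `∑ x n = 2`, gives the constant `C / 2`.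
  have hstep : ∀ n, ‖g n - g (n + 1)‖ ≤ C / 4 * x n := by
    intro n
    have h1 := h (x (n + 1)) (hx0 _).le (by rw [← hxs]; exact hx1 n)
    have e : g n - g (n + 1)
        = (x n)⁻¹ • (f (2 * x (n + 1)) - 2 * f (x (n + 1)) + f 0) := by
      simp only [hg]
      have : (x (n + 1))⁻¹ = (x n)⁻¹ * 2 := by
        rw [hxs n]; have := (hx0 (n + 1)).ne'; field_simp
      rw [this, ← hxs n]
      simp only [Complex.real_smul]
      push_cast
      ring
    rw [e, norm_smul, Real.norm_of_nonneg (inv_nonneg.2 (hx0 n).le)]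
    have hn := hxs n
    calc (x n)⁻¹ * _ ≤ (x n)⁻¹ * (C * x (n + 1) ^ 2) :=
          mul_le_mul_of_nonneg_left h1 (inv_nonneg.2 (hx0 n).le)
      _ = C / 4 * x n := by
          rw [hn]; have := (hx0 (n + 1)).ne'; field_simp; ring
  have hsum : ∀ n, ‖g 0 - g n‖ ≤ C / 2 * (1 - x n) := by
    intro n
    induction n with
    | zero => simp [hx]
    | succ n ih =>
      have h1 := norm_add_le (g 0 - g n) (g n - g (n + 1))
      rw [sub_add_sub_cancel] at h1
      have := hstep n
      have := hxs n
      nlinarith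
  have h2 : Tendsto (fun n => ‖g 0 - g n‖) atTop (𝓝 ‖g 0 - f'‖) :=
    (tendsto_const_nhds.sub hlim).norm
  have h3 : ‖g 0 - f'‖ ≤ C / 2 := le_of_tendsto h2 (Eventually.of_forall fun n =>
    (hsum n).trans (by nlinarith [hx0 n]))
  simpa [hg, hx] using h3

/-- The maximum principle for `u + κ u' = F` on periodic functions. -/
theorem norm_le_of_resolvent {u F : ℝ → ℂ} {κ P M : ℝ} (hP : 0 < P)
    (hu : Differentiable ℝ u) (hper : Function.Periodic u P)
    (heq : ∀ τ, u τ + (κ : ℂ) * deriv u τ = F τ) (hF : ∀ τ, ‖F τ‖ ≤ M) (τ : ℝ) :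
    ‖u τ‖ ≤ M := by
  have hcont : Continuous u := hu.continuous
  obtain ⟨θ, -, hθ⟩ := isCompact_Icc.exists_isMaxOn (nonempty_Icc.2 hP.le)
    (continuous_norm.comp hcont).continuousOn (s := Icc 0 P)
  have hmax : ∀ s, ‖u s‖ ≤ ‖u θ‖ := by
    intro s
    obtain ⟨s', hs', e⟩ := hper.exists_mem_Ico₀ hP s
    rw [e]
    exact hθ ⟨hs'.1, hs'.2.le⟩
  refine (hmax τ).trans ?_
  have hd : HasDerivAt (fun s => ‖u s‖ ^ 2) (2 * inner ℝ (u θ) (deriv u θ)) θ :=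
    (hu θ).hasDerivAt.norm_sq
  -- At a maximum of `‖u‖` the derivative of `‖u‖ ^ 2` vanishes, so pairing the equation with `u`
  -- removes the derivative term for every real `κ`.
  have hz : inner ℝ (u θ) (deriv u θ) = 0 := by
    have hloc : IsLocalMax (fun s => ‖u s‖ ^ 2) θ :=
      Eventually.of_forall fun s => pow_le_pow_left₀ (norm_nonneg _) (hmax s) 2
    have := hloc.hasDerivAt_eq_zero hd
    linarith
  have h1 : inner ℝ (u θ) (F θ) = ‖u θ‖ ^ 2 := by
    rw [← heq θ, inner_add_right, real_inner_self_eq_norm_sq, ← Complex.real_smul,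
      inner_smul_right, hz]
    simp
  have h2 : ‖u θ‖ ^ 2 ≤ ‖u θ‖ * M := by
    rw [← h1]
    exact (real_inner_le_norm _ _).trans (mul_le_mul_of_nonneg_left (hF θ) (norm_nonneg _))
  rcases (norm_nonneg (u θ)).eq_or_lt with h | h
  · rw [← h]; exact (norm_nonneg _).trans (hF θ)
  · nlinarith

/-- Solvability of `u + κ u' = F` in periodic functions. -/
theorem exists_resolvent {F : ℝ → ℂ} {κ P : ℝ} (hκ : 0 < κ) (hP : 0 < P)
    (hF : Continuous F) (hper : Function.Periodic F P) :
    ∃ u : ℝ → ℂ, ContDiff ℝ 1 u ∧ Function.Periodic u P ∧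
      ∀ τ, u τ + (κ : ℂ) * deriv u τ = F τ := by
  set E : ℝ → ℂ := fun τ => ((Real.exp (τ / κ) : ℝ) : ℂ) with hE
  have hE0 : ∀ τ, E τ ≠ 0 := fun τ => by
    simp only [hE]; exact_mod_cast (Real.exp_pos _).ne'
  have hEd : ∀ τ, HasDerivAt E (E τ * (1 / κ)) τ := by
    intro τ
    have h := ((hasDerivAt_id τ).div_const κ).exp.ofReal_comp
    simpa [hE] using h
  have hEc : Continuous E := continuous_iff_continuousAt.2 fun τ => (hEd τ).continuousAt
  have hEadd : ∀ s t, E (s + t) = E s * E t := fun s t => by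
    simp only [hE]; rw [add_div, Real.exp_add]; push_cast; ring
  have hEP : E P - 1 ≠ 0 := by
    simp only [hE]
    have : (1 : ℝ) < Real.exp (P / κ) := by simpa using div_pos hP hκ
    have h2 : (Real.exp (P / κ) - 1 : ℝ) ≠ 0 := by linarith
    exact_mod_cast h2
  set I : ℝ → ℂ := fun τ => ∫ σ in (0 : ℝ)..τ, (1 / κ : ℂ) * (E σ * F σ) with hI
  have hic : Continuous fun σ => (1 / κ : ℂ) * (E σ * F σ) := by fun_prop
  have hId : ∀ τ, HasDerivAt I ((1 / κ : ℂ) * (E τ * F τ)) τ := fun τ =>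
    intervalIntegral.integral_hasDerivAt_right (hic.intervalIntegrable _ _)
      hic.aestronglyMeasurable.stronglyMeasurableAtFilter hic.continuousAt
  have hIP : ∀ τ, I (τ + P) = I P + E P * I τ := by
    intro τ
    have h1 : I (τ + P) = I P + ∫ σ in P..(τ + P), (1 / κ : ℂ) * (E σ * F σ) :=
      (intervalIntegral.integral_add_adjacent_intervals (hic.intervalIntegrable _ _)
        (hic.intervalIntegrable _ _)).symm
    have h2 := intervalIntegral.integral_comp_add_right (a := 0) (b := τ)
      (fun σ => (1 / κ : ℂ) * (E σ * F σ)) P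
    rw [zero_add] at h2
    rw [h1, ← h2, hI]
    simp only
    rw [← intervalIntegral.integral_const_mul]
    congr 2
    ext σ
    rw [hEadd, hper σ]
    ring
  -- Variation of constants: `I P / (E P - 1)` is the integration constant that makes `u` periodic,
  -- by the relation `hIP`.
  set u : ℝ → ℂ := fun τ => (E τ)⁻¹ * (I P / (E P - 1) + I τ) with hu
  have hud : ∀ τ, HasDerivAt u ((1 / κ : ℂ) * (F τ - u τ)) τ := by
    intro τ
    have h := ((hEd τ).inv (hE0 τ)).mul ((hId τ).const_add (I P / (E P - 1)))
    refine h.congr_deriv ?_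
    simp only [hu, Pi.inv_apply]
    have := hE0 τ
    field_simp
    ring
  have hκ' : (κ : ℂ) ≠ 0 := by exact_mod_cast hκ.ne'
  have huc : Continuous u := continuous_iff_continuousAt.2 fun τ => (hud τ).continuousAt
  refine ⟨u, ?_, ?_, ?_⟩
  · rw [contDiff_one_iff_deriv]
    refine ⟨fun τ => (hud τ).differentiableAt, ?_⟩
    have : deriv u = fun τ => (1 / κ : ℂ) * (F τ - u τ) := funext fun τ => (hud τ).deriv
    rw [this]; fun_prop
  · intro τ
    simp only [hu]
    rw [hEadd, hIP]
    have := hE0 τ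
    have := hE0 P
    field_simp
    ring
  · intro τ
    rw [(hud τ).deriv]
    field_simp
    ring

end TwoScale

/-! ### Oscillating primitives and the initial datum. -/

namespace TwoScale

open Set Filter Topology

noncomputable section

section Oscillation

variable {E : Type*} [NormedAddCommGroup E] [NormedSpace ℝ E]

/-- The primitive from `0` of the mean-free part of a `2π`-periodic function. -/
def osc (g : ℝ → E) (τ : ℝ) : E :=
  (∫ σ in (0 : ℝ)..τ, g σ) - (τ / (2 * Real.pi)) • ∫ σ in (0 : ℝ)..(2 * Real.pi), g σ

theorem osc_sub {g h : ℝ → E} (hg : Continuous g) (hh : Continuous h) (τ : ℝ) :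
    osc g τ - osc h τ = osc (fun σ => g σ - h σ) τ := by
  simp only [osc]
  rw [intervalIntegral.integral_sub (hg.intervalIntegrable _ _) (hh.intervalIntegrable _ _),
    intervalIntegral.integral_sub (hg.intervalIntegrable _ _) (hh.intervalIntegrable _ _),
    smul_sub]
  abel

theorem osc_periodic {g : ℝ → E} (hg : Continuous g) (hp : Function.Periodic g (2 * Real.pi)) :
    Function.Periodic (osc g) (2 * Real.pi) := by
  intro τ
  simp only [osc]
  rw [← intervalIntegral.integral_add_adjacent_intervals (hg.intervalIntegrable 0 τ)
    (hg.intervalIntegrable τ _), hp.intervalIntegral_add_eq τ 0, zero_add, add_div,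
    div_self (by positivity), add_smul, one_smul]
  abel

/-- By periodicity `τ` may be taken in one period, where the primitive and its linear correction are
each at most `2πQ`. -/
theorem norm_osc_le {g : ℝ → E} {Q : ℝ} (hg : Continuous g)
    (hp : Function.Periodic g (2 * Real.pi)) (hQ : ∀ σ, ‖g σ‖ ≤ Q) (τ : ℝ) :
    ‖osc g τ‖ ≤ 4 * Real.pi * Q := by
  obtain ⟨s, hs, e⟩ := (osc_periodic hg hp).exists_mem_Ico₀ Real.two_pi_pos τ
  rw [e]
  have hQ0 : 0 ≤ Q := (norm_nonneg _).trans (hQ 0)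
  have hpi := Real.pi_pos
  have h1 : ∀ t : ℝ, 0 ≤ t → ‖∫ σ in (0 : ℝ)..t, g σ‖ ≤ Q * t := fun t ht => by
    have := intervalIntegral.norm_integral_le_of_norm_le_const (a := 0) (b := t) (f := g)
      (fun x _ => hQ x)
    rwa [sub_zero, abs_of_nonneg ht] at this
  have h2 := h1 s hs.1
  have h3 := h1 (2 * Real.pi) (by positivity)
  have h4 : ‖(s / (2 * Real.pi)) • ∫ σ in (0 : ℝ)..(2 * Real.pi), g σ‖ ≤ Q * s := by
    rw [norm_smul, Real.norm_of_nonneg (div_nonneg hs.1 (by positivity))]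
    calc _ ≤ s / (2 * Real.pi) * (Q * (2 * Real.pi)) :=
          mul_le_mul_of_nonneg_left h3 (div_nonneg hs.1 (by positivity))
      _ = Q * s := by field_simp
  refine (norm_sub_le _ _).trans ?_
  have := hs.2
  nlinarith

theorem hasDerivAt_osc [CompleteSpace E] {g : ℝ → E} (hg : Continuous g) (τ : ℝ) :
    HasDerivAt (osc g)
      (g τ - (1 / (2 * Real.pi)) • ∫ σ in (0 : ℝ)..(2 * Real.pi), g σ) τ := by
  have h1 := intervalIntegral.integral_hasDerivAt_right (hg.intervalIntegrable 0 τ)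
    hg.aestronglyMeasurable.stronglyMeasurableAtFilter hg.continuousAt
  have h2 := ((hasDerivAt_id τ).div_const (2 * Real.pi)).smul_const
    (∫ σ in (0 : ℝ)..(2 * Real.pi), g σ)
  exact h1.sub h2

theorem norm_mean_le {g : ℝ → E} {Q : ℝ} (hQ : ∀ σ, ‖g σ‖ ≤ Q) :
    ‖(1 / (2 * Real.pi)) • ∫ σ in (0 : ℝ)..(2 * Real.pi), g σ‖ ≤ Q := by
  have hpi := Real.pi_pos
  have := intervalIntegral.norm_integral_le_of_norm_le_const (a := 0) (b := 2 * Real.pi) (f := g)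
      (fun x _ => hQ x)
  rw [sub_zero, abs_of_nonneg (by positivity)] at this
  rw [norm_smul, Real.norm_of_nonneg (by positivity)]
  calc _ ≤ 1 / (2 * Real.pi) * (Q * (2 * Real.pi)) :=
        mul_le_mul_of_nonneg_left this (by positivity)
    _ = Q := by field_simp

theorem norm_osc_sub_le [CompleteSpace E] {g : ℝ → E} {Q : ℝ} (hg : Continuous g)
    (hQ : ∀ σ, ‖g σ‖ ≤ Q) (τ τ' : ℝ) : ‖osc g τ - osc g τ'‖ ≤ 2 * Q * |τ - τ'| := by
  refine convex_univ.norm_image_sub_le_of_norm_hasDerivWithin_le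
    (fun x _ => (hasDerivAt_osc hg x).hasDerivWithinAt) (fun x _ => ?_) (mem_univ _) (mem_univ _)
  refine (norm_sub_le _ _).trans ?_
  have h1 := norm_mean_le hQ
  have h2 := hQ x
  linarith

end Oscillation

theorem average_eq (g : ℝ → ℂ) :
    average g = (1 / (2 * Real.pi)) • ∫ σ in (0 : ℝ)..(2 * Real.pi), g σ := by
  simp [average]

theorem source_periodic (r : ℂ → ℂ) (z : ℂ) :
    Function.Periodic (fun σ => source r σ z) (2 * Real.pi) := by
  intro σ
  have h : Complex.exp (Complex.I * ((σ + 2 * Real.pi : ℝ) : ℂ))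
      = Complex.exp (Complex.I * σ) := by
    rw [Complex.exp_eq_exp_iff_exists_int]
    exact ⟨1, by push_cast; ring⟩
  simp only [source, Complex.exp_neg, h]

theorem continuous_source {r : ℂ → ℂ} (hr : Continuous r) {u : ℝ → ℂ} (hu : Continuous u) :
    Continuous fun σ => source r σ (u σ) := by
  unfold source
  fun_prop

/-- The normalising constant of `L⁻¹` cancels in the difference. -/
theorem corrector_zero_sub {r : ℂ → ℂ} (hr : Continuous r) (τ : ℝ) (z : ℂ) :
    corrector r 0 z - corrector r τ z = - osc (fun σ => source r σ z) τ := by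
  have hc : Continuous fun σ => source r σ z := continuous_source hr continuous_const
  simp only [corrector, primitive, osc, average_eq]
  rw [intervalIntegral.integral_same, intervalIntegral.integral_sub (hc.intervalIntegrable _ _)
    (continuous_const.intervalIntegrable _ _), intervalIntegral.integral_const, smul_smul]
  rw [sub_zero, mul_one_div]
  abel

theorem initialData_eq {r : ℂ → ℂ} (hr : Continuous r) (a : ℝ → ℝ) (α : ℝ → ℂ) (ε x τ : ℝ) :
    initialData r a α ε x τ
      = α x - ((ε / a x : ℝ) : ℂ) * osc (fun σ => source r σ (α x)) τ := by
  rw [initialData, corrector_zero_sub hr]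
  ring

/-- Multiplied by `-a/ε`, this derivative is the mean-free part of the source at `α`: at time `0`
the stiff term cancels the oscillation of the source up to order `ε`. -/
theorem hasDerivAt_initialData {r : ℂ → ℂ} (hr : Continuous r) (a : ℝ → ℝ) (α : ℝ → ℂ)
    (ε x τ : ℝ) : HasDerivAt (initialData r a α ε x)
      (-(((ε / a x : ℝ) : ℂ) * (source r τ (α x) - average fun s => source r s (α x)))) τ := by
  have hc : Continuous fun σ => source r σ (α x) := continuous_source hr continuous_const
  have h := ((hasDerivAt_osc hc τ).const_mul ((ε / a x : ℝ) : ℂ)).const_sub (α x)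
  rw [← average_eq] at h
  exact h.congr_of_eventuallyEq (Eventually.of_forall fun s => initialData_eq hr a α ε x s)

theorem contDiff_initialData {r : ℂ → ℂ} (hr : Continuous r) (a : ℝ → ℝ) (α : ℝ → ℂ)
    (ε x : ℝ) : ContDiff ℝ 1 (initialData r a α ε x) := by
  rw [contDiff_one_iff_deriv]
  refine ⟨fun τ => (hasDerivAt_initialData hr a α ε x τ).differentiableAt, ?_⟩
  rw [funext fun τ => (hasDerivAt_initialData hr a α ε x τ).deriv]
  have hc : Continuous fun σ => source r σ (α x) := continuous_source hr continuous_const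
  fun_prop

theorem initialData_periodic {r : ℂ → ℂ} (hr : Continuous r) (a : ℝ → ℝ) (α : ℝ → ℂ)
    (ε x : ℝ) : Function.Periodic (initialData r a α ε x) (2 * Real.pi) := by
  intro τ
  have hc : Continuous fun σ => source r σ (α x) := continuous_source hr continuous_const
  rw [initialData_eq hr, initialData_eq hr, osc_periodic hc (source_periodic r _)]

theorem DiffBound.norm_fderiv_le {g : ℂ → ℂ} {K : ℝ} (hg : DiffBound K g) (hK : 0 ≤ K) (z : ℂ) :
    ‖fderiv ℝ g z‖ ≤ K :=
  norm_fderiv_le_of_lip' ℝ hK (Eventually.of_forall fun w => hg.lip w z)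

/-- The mixed bound says that the increment functions at `p` and `p'` differ by at most a multiple
of `‖q‖`; this passes to their derivatives at `q = 0`. -/
theorem DiffBound.norm_fderiv_sub_le {g : ℂ → ℂ} {K : ℝ} (hg : DiffBound K g)
    (hd : Differentiable ℝ g) (hK : 0 ≤ K) (p p' : ℂ) :
    ‖fderiv ℝ g p - fderiv ℝ g p'‖ ≤ K * ‖p - p'‖ := by
  have h1 : ∀ p, HasFDerivAt (fun q => g (p + q)) (fderiv ℝ g p) 0 := fun p => by
    have h : HasFDerivAt g (fderiv ℝ g p) (p + 0) := by
      rw [add_zero]; exact (hd p).hasFDerivAt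
    exact h.comp (0 : ℂ) ((hasFDerivAt_id (0 : ℂ)).const_add p)
  refine ((h1 p).sub (h1 p')).le_of_lip' (by positivity) (Eventually.of_forall fun q => ?_)
  have := hg.mixed p p' q
  calc _ = ‖(g (p + q) - g p) - (g (p' + q) - g p')‖ := by
        congr 1; simp only [add_zero, Pi.sub_apply]; ring
    _ ≤ _ := by rw [sub_zero]; linarith

theorem hasFDerivAt_source {r : ℂ → ℂ} (hr : Differentiable ℝ r) (τ : ℝ) (z : ℂ) :
    HasFDerivAt (source r τ) (Complex.exp (-(Complex.I * τ)) •
      (fderiv ℝ r (Complex.exp (Complex.I * τ) * z)).comp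
        (Complex.exp (Complex.I * τ) • ContinuousLinearMap.id ℝ ℂ)) z := by
  have h1 : HasFDerivAt (fun w : ℂ => Complex.exp (Complex.I * τ) * w)
      (Complex.exp (Complex.I * τ) • ContinuousLinearMap.id ℝ ℂ) z :=
    (hasFDerivAt_id z).const_mul _
  exact ((hr _).hasFDerivAt.comp z h1).const_mul _

theorem continuous_fderiv_source {r : ℂ → ℂ} (hr : Differentiable ℝ r)
    (hr' : Continuous (fderiv ℝ r)) (z : ℂ) :
    Continuous fun τ : ℝ => fderiv ℝ (source r τ) z := by
  rw [funext fun τ => (hasFDerivAt_source hr τ z).fderiv]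
  fun_prop

theorem fderiv_source_periodic (r : ℂ → ℂ) (z : ℂ) :
    Function.Periodic (fun σ : ℝ => fderiv ℝ (source r σ) z) (2 * Real.pi) := by
  intro σ
  have : source r (σ + 2 * Real.pi) = source r σ := funext fun w => source_periodic r w σ
  simp only [this]

theorem hasFDerivAt_osc_source {r : ℂ → ℂ} {K : ℝ} (hK : 0 ≤ K) (hr : Differentiable ℝ r)
    (hr' : Continuous (fderiv ℝ r)) (hb : DiffBound K r) (τ : ℝ) (z : ℂ) :
    HasFDerivAt (fun w => osc (fun σ => source r σ w) τ)
      (osc (fun σ => fderiv ℝ (source r σ) z) τ) z := by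
  have h : ∀ t : ℝ, HasFDerivAt (fun w => ∫ σ in (0 : ℝ)..t, source r σ w)
      (∫ σ in (0 : ℝ)..t, fderiv ℝ (source r σ) z) z := by
    intro t
    refine intervalIntegral.hasFDerivAt_integral_of_dominated_of_fderiv_le
      (F' := fun w σ => fderiv ℝ (source r σ) w) (bound := fun _ => K) univ_mem
      (Eventually.of_forall fun w =>
        (continuous_source hr.continuous continuous_const).aestronglyMeasurable)
      ((continuous_source hr.continuous continuous_const).intervalIntegrable _ _)
      (continuous_fderiv_source hr hr' z).aestronglyMeasurable ?_ ?_ ?_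
    · exact Eventually.of_forall fun σ _ w _ => (hb.source σ).norm_fderiv_le hK w
    · exact continuous_const.intervalIntegrable _ _
    · exact Eventually.of_forall fun σ _ w _ =>
        (hasFDerivAt_source hr σ w).differentiableAt.hasFDerivAt
  exact (h τ).sub ((h _).const_smul _)

end

end TwoScale

/-! ### Well-posedness of the scheme. -/

namespace TwoScale

open Set Filter Topology

noncomputable section

/-- The explicit part of one step of the scheme. -/
def explicitStep (r : ℂ → ℂ) (c Δt Δx : ℝ) (u um : ℝ → ℂ) (τ : ℝ) : ℂ :=
  u τ - (Δt : ℂ) * ((c : ℂ) * ((u τ - um τ) / (Δx : ℂ)) + source r τ (u τ))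

theorem step_iff {w u X S A d : ℂ} {Δt : ℝ} (h : 0 < Δt) :
    (w - u) / (Δt : ℂ) + X + S = -A * d ↔ w + (Δt * A) * d = u - Δt * (X + S) := by
  have : (Δt : ℂ) ≠ 0 := by exact_mod_cast h.ne'
  constructor
  · intro e
    field_simp at e
    linear_combination e
  · intro e
    field_simp
    linear_combination e

/-- The scheme in solved form: `ε` enters only through the coefficient of the resolvent equation, to
which the maximum principle is insensitive. -/
theorem step_iff_resolvent {r : ℂ → ℂ} {c Δt Δx A ε τ : ℝ} (h : 0 < Δt) (w u um : ℝ → ℂ) :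
    ((w τ - u τ) / (Δt : ℂ) + (c : ℂ) * ((u τ - um τ) / (Δx : ℂ)) + source r τ (u τ)
      = -((A / ε : ℝ) : ℂ) * deriv w τ) ↔
    w τ + ((Δt * (A / ε) : ℝ) : ℂ) * deriv w τ = explicitStep r c Δt Δx u um τ := by
  rw [step_iff h, explicitStep]
  push_cast
  rfl

theorem continuous_explicitStep {r : ℂ → ℂ} (hr : Continuous r) (c Δt Δx : ℝ) {u um : ℝ → ℂ}
    (hu : Continuous u) (hum : Continuous um) : Continuous (explicitStep r c Δt Δx u um) := by
  have := continuous_source hr hu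
  unfold explicitStep
  fun_prop

theorem explicitStep_periodic (r : ℂ → ℂ) (c Δt Δx : ℝ) {u um : ℝ → ℂ}
    (hu : Function.Periodic u (2 * Real.pi)) (hum : Function.Periodic um (2 * Real.pi)) :
    Function.Periodic (explicitStep r c Δt Δx u um) (2 * Real.pi) := by
  intro τ
  have := source_periodic r (u τ) τ
  simp only at this
  simp only [explicitStep, hu τ, hum τ, this]

open Classical in
/-- A `2π`-periodic `C¹` solution of `u + κ u' = F`. -/
def resolvent (κ : ℝ) (F : ℝ → ℂ) : ℝ → ℂ :=
  if h : ∃ u : ℝ → ℂ, ContDiff ℝ 1 u ∧ Function.Periodic u (2 * Real.pi) ∧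
      ∀ τ, u τ + (κ : ℂ) * deriv u τ = F τ then h.choose else 0

theorem resolvent_spec {κ : ℝ} {F : ℝ → ℂ} (hκ : 0 < κ) (hF : Continuous F)
    (hper : Function.Periodic F (2 * Real.pi)) :
    ContDiff ℝ 1 (resolvent κ F) ∧ Function.Periodic (resolvent κ F) (2 * Real.pi) ∧
      ∀ τ, resolvent κ F τ + (κ : ℂ) * deriv (resolvent κ F) τ = F τ := by
  have h := exists_resolvent hκ Real.two_pi_pos hF hper
  rw [resolvent, dif_pos h]
  exact h.choose_spec

/-- The iterates of the scheme. -/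
def schemeIterate (r : ℂ → ℂ) (a : ℝ → ℝ) (α : ℝ → ℂ) (c ε Δt : ℝ) (M : ℕ) :
    ℕ → ℤ → ℝ → ℂ
  | 0 => fun j => initialData r a α ε (j * (1 / M))
  | n + 1 => fun j => resolvent (Δt * (a (j * (1 / M)) / ε))
      (explicitStep r c Δt (1 / M) (schemeIterate r a α c ε Δt M n j)
        (schemeIterate r a α c ε Δt M n (j - 1)))

theorem isSchemeSolution_schemeIterate {r : ℂ → ℂ} (hr : Continuous r) {a : ℝ → ℝ}
    (ha : ∀ x, 0 < a x) (ha_per : Function.Periodic a 1) {α : ℝ → ℂ}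
    (hα_per : Function.Periodic α 1) (c : ℝ) {ε Δt : ℝ} (hε : 0 < ε) (hΔt : 0 < Δt) {M : ℕ}
    (hM : 0 < M) : IsSchemeSolution r a α c ε Δt M (schemeIterate r a α c ε Δt M) := by
  set v := schemeIterate r a α c ε Δt M with hv
  have hM' : (M : ℝ) ≠ 0 := by exact_mod_cast hM.ne'
  have hx : ∀ j : ℤ, ((j + M : ℤ) : ℝ) * (1 / M) = j * (1 / M) + 1 := fun j => by
    push_cast; field_simp
  have hκ : ∀ j : ℤ, 0 < Δt * (a (j * (1 / M)) / ε) := fun j =>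
    mul_pos hΔt (div_pos (ha _) hε)
  have hreg : ∀ n j, ContDiff ℝ 1 (v n j) ∧ Function.Periodic (v n j) (2 * Real.pi) := by
    intro n
    induction n with
    | zero => exact fun j => ⟨contDiff_initialData hr a α ε _, initialData_periodic hr a α ε _⟩
    | succ n ih =>
      intro j
      have := resolvent_spec (hκ j) (continuous_explicitStep hr c Δt (1 / M)
        (ih j).1.continuous (ih (j - 1)).1.continuous)
        (explicitStep_periodic r c Δt (1 / M) (ih j).2 (ih (j - 1)).2)
      exact ⟨this.1, this.2.1⟩
  have hperx : ∀ n j, v n (j + M) = v n j := by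
    intro n
    induction n with
    | zero =>
      intro j
      funext τ
      simp only [hv, schemeIterate, initialData]
      rw [hx, ha_per, hα_per]
    | succ n ih =>
      intro j
      have h1 : v n (j + M - 1) = v n (j - 1) := by
        rw [show j + (M : ℤ) - 1 = j - 1 + M by ring]; exact ih _
      change resolvent _ _ = resolvent _ _
      rw [hx, ha_per]
      change resolvent _ (explicitStep r c Δt (1 / M) (v n (j + M)) (v n (j + M - 1))) = _
      rw [h1, ih]
  refine ⟨fun n j => (hreg n j).1, fun n j τ => by rw [hperx], fun n j τ => (hreg n j).2 τ,
    fun j τ => rfl, fun n j τ => ?_⟩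
  rw [step_iff_resolvent hΔt]
  exact (resolvent_spec (hκ j) (continuous_explicitStep hr c Δt (1 / M)
        (hreg n j).1.continuous (hreg n (j - 1)).1.continuous)
        (explicitStep_periodic r c Δt (1 / M) (hreg n j).2 (hreg n (j - 1)).2)).2.2 τ

/-- Once level `n` agrees, the difference at level `n + 1` solves the resolvent equation with zero
right-hand side, and the maximum principle makes it vanish. -/
theorem IsSchemeSolution.unique {r : ℂ → ℂ} {a : ℝ → ℝ} {α : ℝ → ℂ} {c ε Δt : ℝ} {M : ℕ}
    (hΔt : 0 < Δt) {v w : ℕ → ℤ → ℝ → ℂ} (hv : IsSchemeSolution r a α c ε Δt M v)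
    (hw : IsSchemeSolution r a α c ε Δt M w) : v = w := by
  funext n
  induction n with
  | zero => funext j τ; rw [hv.initial, hw.initial]
  | succ n ih =>
    funext j τ
    have hdv := (hv.contDiff (n + 1) j).differentiable one_ne_zero
    have hdw := (hw.contDiff (n + 1) j).differentiable one_ne_zero
    have h := norm_le_of_resolvent (u := v (n + 1) j - w (n + 1) j) (F := 0)
      (κ := Δt * (a (j * (1 / M)) / ε)) (M := 0) Real.two_pi_pos (hdv.sub hdw)
      (Function.Periodic.sub (hv.periodic_tau (n + 1) j) (hw.periodic_tau (n + 1) j))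
      (fun s => ?_) (by simp) τ
    · exact sub_eq_zero.1 (norm_le_zero_iff.1 h)
    · have h1 := (step_iff_resolvent hΔt _ _ _).1 (hv.step n j s)
      have h2 := (step_iff_resolvent hΔt _ _ _).1 (hw.step n j s)
      rw [deriv_sub (hdv s) (hdw s), Pi.sub_apply, Pi.zero_apply]
      rw [ih] at h1
      linear_combination h1 - h2

end

end TwoScale

/-! ### Calculus of bounded Lipschitz functions and the straightened space variable. -/

namespace TwoScale

open Set Filter Topology

/-- `f` is bounded by `C` and Lipschitz with constant `C` with respect to `d`. -/
structure BddLip {X E : Type*} [NormedAddCommGroup E] (d : X → X → ℝ) (C : ℝ) (f : X → E) :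
    Prop where
  bdd : ∀ x, ‖f x‖ ≤ C
  lip : ∀ x y, ‖f x - f y‖ ≤ C * d x y

namespace BddLip

variable {X E F : Type*} [NormedAddCommGroup E] [NormedAddCommGroup F]
  {d : X → X → ℝ} {C C' : ℝ}

theorem mono {f : X → E} (hf : BddLip d C f) (h : C ≤ C') (hd : ∀ x y, 0 ≤ d x y) :
    BddLip d C' f :=
  ⟨fun x => (hf.bdd x).trans h, fun x y => (hf.lip x y).trans
    (mul_le_mul_of_nonneg_right h (hd x y))⟩

/-- Allows finitely many constants to be merged into one by intersecting eventual conditions. -/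
theorem eventually {f : X → E} (hf : BddLip d C f) (hd : ∀ x y, 0 ≤ d x y) :
    ∀ᶠ K in atTop, BddLip d K f :=
  (eventually_ge_atTop C).mono fun _ h => hf.mono h hd

theorem add {f g : X → E} (hf : BddLip d C f) (hg : BddLip d C' g) :
    BddLip d (C + C') fun x => f x + g x where
  bdd x := (norm_add_le _ _).trans (add_le_add (hf.bdd x) (hg.bdd x))
  lip x y := by
    rw [add_sub_add_comm, add_mul]
    exact (norm_add_le _ _).trans (add_le_add (hf.lip x y) (hg.lip x y))

theorem sub {f g : X → E} (hf : BddLip d C f) (hg : BddLip d C' g) :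
    BddLip d (C + C') fun x => f x - g x where
  bdd x := (norm_sub_le _ _).trans (add_le_add (hf.bdd x) (hg.bdd x))
  lip x y := by
    rw [sub_sub_sub_comm, add_mul]
    exact (norm_sub_le _ _).trans (add_le_add (hf.lip x y) (hg.lip x y))

theorem neg {f : X → E} (hf : BddLip d C f) : BddLip d C fun x => -f x where
  bdd x := by rw [norm_neg]; exact hf.bdd x
  lip x y := by rw [← neg_sub', norm_neg]; exact hf.lip x y

theorem smul [NormedSpace ℝ E] {f : X → ℝ} {g : X → E} (hf : BddLip d C f)
    (hg : BddLip d C' g) : BddLip d (2 * (C * C')) fun x => f x • g x where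
  bdd x := by
    have hC := (norm_nonneg _).trans (hf.bdd x)
    have hC' := (norm_nonneg _).trans (hg.bdd x)
    rw [norm_smul]
    have := mul_le_mul (hf.bdd x) (hg.bdd x) (norm_nonneg _) hC
    have := mul_nonneg hC hC'
    linarith
  lip x y := by
    have hC := (norm_nonneg _).trans (hf.bdd x)
    have hC' := (norm_nonneg _).trans (hg.bdd x)
    have e : f x • g x - f y • g y = f x • (g x - g y) + (f x - f y) • g y := by
      rw [smul_sub, sub_smul]; abel
    rw [e]
    refine (norm_add_le _ _).trans ?_
    rw [norm_smul, norm_smul]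
    have h1 := mul_le_mul (hf.bdd x) (hg.lip x y) (norm_nonneg _) hC
    have h2 := mul_le_mul (hf.lip x y) (hg.bdd y) (norm_nonneg _)
      ((norm_nonneg _).trans (hf.lip x y))
    linarith

theorem clm_apply [NormedSpace ℝ E] [NormedSpace ℝ F] {f : X → E →L[ℝ] F} {g : X → E}
    (hf : BddLip d C f) (hg : BddLip d C' g) : BddLip d (2 * (C * C')) fun x => f x (g x) where
  bdd x := by
    have hC := (norm_nonneg _).trans (hf.bdd x)
    have hC' := (norm_nonneg _).trans (hg.bdd x)
    have h0 := (f x).le_opNorm (g x)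
    have := mul_le_mul (hf.bdd x) (hg.bdd x) (norm_nonneg _) hC
    have := mul_nonneg hC hC'
    linarith
  lip x y := by
    have hC := (norm_nonneg _).trans (hf.bdd x)
    have hC' := (norm_nonneg _).trans (hg.bdd x)
    have e : f x (g x) - f y (g y) = f x (g x - g y) + (f x - f y) (g y) := by simp
    rw [e]
    refine (norm_add_le _ _).trans ?_
    have h1 := mul_le_mul (hf.bdd x) (hg.lip x y) (norm_nonneg _) hC
    have h2 := mul_le_mul (hf.lip x y) (hg.bdd y) (norm_nonneg _)
      ((norm_nonneg _).trans (hf.lip x y))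
    have h3 := (f x).le_opNorm (g x - g y)
    have h4 := (f x - f y).le_opNorm (g y)
    linarith

theorem const (d : X → X → ℝ) (hd : ∀ x y, 0 ≤ d x y) (v : E) : BddLip d ‖v‖ fun _ : X => v where
  bdd _ := le_rfl
  lip x y := by rw [sub_self, norm_zero]; exact mul_nonneg (norm_nonneg _) (hd x y)

theorem inv {f : X → ℝ} {m : ℝ} (hm : 0 < m) (hf : BddLip d C f) (hfm : ∀ x, m ≤ f x) :
    BddLip d (max m⁻¹ (m⁻¹ * m⁻¹ * C)) fun x => (f x)⁻¹ where
  bdd x := by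
    rw [norm_inv, Real.norm_of_nonneg (hm.le.trans (hfm x))]
    exact (inv_anti₀ hm (hfm x)).trans (le_max_left _ _)
  lip x y := by
    have hx := hm.trans_le (hfm x)
    have hy := hm.trans_le (hfm y)
    have e : (f x)⁻¹ - (f y)⁻¹ = -((f x)⁻¹ * (f y)⁻¹ * (f x - f y)) := by
      field_simp; ring
    have hC := (norm_nonneg _).trans (hf.bdd x)
    have hl := hf.lip x y
    have hm' : 0 < m⁻¹ := inv_pos.2 hm
    have hmm : (f x)⁻¹ * (f y)⁻¹ ≤ m⁻¹ * m⁻¹ :=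
      mul_le_mul (inv_anti₀ hm (hfm x)) (inv_anti₀ hm (hfm y)) (inv_nonneg.2 hy.le) hm'.le
    rw [e, norm_neg, norm_mul, Real.norm_of_nonneg (by positivity)]
    have h1 : (f x)⁻¹ * (f y)⁻¹ * ‖f x - f y‖ ≤ m⁻¹ * m⁻¹ * (C * d x y) :=
      mul_le_mul hmm hl (norm_nonneg _) (by positivity)
    -- The sign of `d x y` is not assumed. If `C > 0` it follows from the Lipschitz bound; `C = 0`
    -- would force `f x = 0`, against `m ≤ f x`.
    rcases hC.eq_or_lt with h0 | h0
    · rw [← h0] at h1 ⊢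
      have := hf.bdd x
      rw [← h0] at this
      have := norm_le_zero_iff.1 this
      linarith
    · have hd : 0 ≤ d x y := by
        have := (norm_nonneg _).trans hl
        exact nonneg_of_mul_nonneg_right this h0
      refine h1.trans ?_
      rw [← mul_assoc]
      exact mul_le_mul_of_nonneg_right (le_max_right _ _) hd

end BddLip

/-- The distance on the real line. -/
def lineDist (x y : ℝ) : ℝ := |x - y|

theorem lineDist_nonneg (x y : ℝ) : 0 ≤ lineDist x y := abs_nonneg _

theorem BddLip.comp_lipschitz {E : Type*} [NormedAddCommGroup E] {C L : ℝ} {f : ℝ → E}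
    {B : ℝ → ℝ} (hf : BddLip lineDist C f) (hB : ∀ x y, |B x - B y| ≤ L * |x - y|) :
    BddLip lineDist (max C (C * L)) (fun y => f (B y)) where
  bdd x := (hf.bdd _).trans (le_max_left _ _)
  lip x y := by
    have hC := (norm_nonneg _).trans (hf.bdd 0)
    have h1 : C * lineDist (B x) (B y) ≤ C * (L * |x - y|) :=
      mul_le_mul_of_nonneg_left (hB x y) hC
    have h2 : C * L * |x - y| ≤ max C (C * L) * |x - y| :=
      mul_le_mul_of_nonneg_right (le_max_right _ _) (abs_nonneg _)
    have := hf.lip (B x) (B y)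
    simp only [lineDist] at *
    linarith

theorem exists_bddLip_of_periodic {E : Type*} [NormedAddCommGroup E] [NormedSpace ℝ E]
    {f : ℝ → E} (hf : ContDiff ℝ 2 f) (hp : Function.Periodic f 1) :
    ∃ K, BddLip lineDist K f ∧ BddLip lineDist K (deriv f) := by
  have hbdd : ∀ g : ℝ → E, Continuous g → Function.Periodic g 1 → ∃ K, ∀ x, ‖g x‖ ≤ K := by
    intro g hg hgp
    obtain ⟨K, hK⟩ := isCompact_Icc.exists_bound_of_continuousOn (hg.continuousOn (s := Icc 0 1))
    refine ⟨K, fun x => ?_⟩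
    obtain ⟨y, hy, e⟩ := hgp.exists_mem_Ico₀ one_pos x
    rw [e]; exact hK y ⟨hy.1, hy.2.le⟩
  have hper : ∀ g : ℝ → E, Function.Periodic g 1 → Function.Periodic (deriv g) 1 := by
    intro g hg x
    rw [← deriv_comp_add_const]
    congr 1
    exact funext hg
  have h2 : ContDiff ℝ (1 + 1) f := by simpa [one_add_one_eq_two] using hf
  have hd1 : ContDiff ℝ 1 (deriv f) := (contDiff_succ_iff_deriv.1 h2).2.2
  have hd2 : Continuous (deriv (deriv f)) := (contDiff_one_iff_deriv.1 hd1).2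
  obtain ⟨K0, h0⟩ := hbdd f hf.continuous hp
  obtain ⟨K1, h1⟩ := hbdd _ hd1.continuous (hper _ hp)
  obtain ⟨K2, h2⟩ := hbdd _ hd2 (hper _ (hper _ hp))
  have hlip : ∀ (g : ℝ → E) (C : ℝ), Differentiable ℝ g → (∀ x, ‖deriv g x‖ ≤ C) → ∀ x y,
      ‖g x - g y‖ ≤ C * lineDist x y := fun g C hg hC x y =>
    convex_univ.norm_image_sub_le_of_norm_deriv_le (fun z _ => hg z) (fun z _ => hC z)
      (mem_univ y) (mem_univ x)
  have e1 : K1 ≤ max (max K0 K1) K2 := (le_max_right _ _).trans (le_max_left _ _)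
  refine ⟨max (max K0 K1) K2,
    ⟨fun x => (h0 x).trans ((le_max_left _ _).trans (le_max_left _ _)), fun x y => ?_⟩,
    ⟨fun x => (h1 x).trans e1, fun x y => ?_⟩⟩
  · exact hlip _ _ (hf.differentiable two_ne_zero) (fun z => (h1 z).trans e1) x y
  · exact hlip _ _ (hd1.differentiable one_ne_zero)
      (fun z => (h2 z).trans (le_max_right _ _)) x y

/-- Bounds, by one constant, for the data of the problem in the space variable in which the phase
speed is constant: `b` is the inverse of the phase speed and `β` the leading initial datum. -/
structure ClockData (K : ℝ) (b b' : ℝ → ℝ) (β β' : ℝ → ℂ) : Prop where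
  one_le : 1 ≤ K
  b_pos : ∀ y, 0 < b y
  hb : ∀ y, HasDerivAt b (b' y) y
  hβ : ∀ y, HasDerivAt β (β' y) y
  b_lip : BddLip lineDist K b
  b'_lip : BddLip lineDist K b'
  β_lip : BddLip lineDist K β
  β'_lip : BddLip lineDist K β'
  inv_lip : BddLip lineDist K fun y => (b y)⁻¹

theorem ClockData.mono {K K' : ℝ} {b b' : ℝ → ℝ} {β β' : ℝ → ℂ} (h : ClockData K b b' β β')
    (hK : K ≤ K') : ClockData K' b b' β β' where
  one_le := h.one_le.trans hK
  b_pos := h.b_pos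
  hb := h.hb
  hβ := h.hβ
  b_lip := h.b_lip.mono hK lineDist_nonneg
  b'_lip := h.b'_lip.mono hK lineDist_nonneg
  β_lip := h.β_lip.mono hK lineDist_nonneg
  β'_lip := h.β'_lip.mono hK lineDist_nonneg
  inv_lip := h.inv_lip.mono hK lineDist_nonneg

/-- `A` is a primitive of `a`. Its slope is at least `a₀`, so it is a bijection of the line whose
inverse `B` is Lipschitz with constant `a₀⁻¹`. Periodicity and `C²` regularity of `a` and `α`
provide the global bounds, which composition with `B` preserves up to constants. -/
theorem exists_clock {a : ℝ → ℝ} (ha : ContDiff ℝ 2 a) (ha_per : Function.Periodic a 1)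
    {a₀ : ℝ} (ha₀ : 0 < a₀) (ha_pos : ∀ x, a₀ ≤ a x) {α : ℝ → ℂ} (hα : ContDiff ℝ 2 α)
    (hα_per : Function.Periodic α 1) :
    ∃ (K : ℝ) (A B b' : ℝ → ℝ) (β' : ℝ → ℂ), (∀ x, HasDerivAt A (a x) x) ∧
      (∀ y, HasDerivAt B (a (B y))⁻¹ y) ∧ (∀ x, B (A x) = x) ∧ (∀ y, A (B y) = y) ∧
      BddLip lineDist K a ∧
      ClockData K (fun y => (a (B y))⁻¹) b' (fun y => α (B y)) β' := by
  set A : ℝ → ℝ := fun x => ∫ s in (0 : ℝ)..x, a s with hA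
  have hAd : ∀ x, HasDerivAt A (a x) x := fun x =>
    intervalIntegral.integral_hasDerivAt_right (ha.continuous.intervalIntegrable _ _)
      ha.continuous.aestronglyMeasurable.stronglyMeasurableAtFilter ha.continuous.continuousAt
  have hmono : Monotone fun x => A x - a₀ * x := by
    refine monotone_of_deriv_nonneg
      (fun x => ((hAd x).sub ((hasDerivAt_id x).const_mul a₀)).differentiableAt) fun x => ?_
    have h : HasDerivAt (fun x => A x - a₀ * x) (a x - a₀ * 1) x :=
      (hAd x).sub ((hasDerivAt_id x).const_mul a₀)
    rw [h.deriv]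
    linarith [ha_pos x]
  have hlow : ∀ x y, x ≤ y → a₀ * (y - x) ≤ A y - A x := fun x y hxy => by
    have := hmono hxy
    simp only at this
    linarith
  have hA0 : A 0 = 0 := by simp [hA]
  have hAc : Continuous A := continuous_iff_continuousAt.2 fun x => (hAd x).continuousAt
  have hsurj : Function.Surjective A := by
    refine hAc.surjective ?_ ?_
    · refine tendsto_atTop_mono' _ ?_ (tendsto_id.const_mul_atTop ha₀)
      filter_upwards [eventually_ge_atTop 0] with x hx
      have := hlow 0 x hx
      simp only [id]
      linarith
    · refine tendsto_atBot_mono' _ ?_ (tendsto_id.const_mul_atBot ha₀)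
      filter_upwards [eventually_le_atBot 0] with x hx
      have := hlow x 0 hx
      simp only [id]
      linarith
  have habs : ∀ x y, a₀ * |x - y| ≤ |A x - A y| := fun x y => by
    rcases le_total x y with h | h
    · rw [abs_sub_comm, abs_sub_comm (A x), abs_of_nonneg (sub_nonneg.2 h)]
      exact (hlow x y h).trans (le_abs_self _)
    · rw [abs_of_nonneg (sub_nonneg.2 h)]
      exact (hlow y x h).trans (le_abs_self _)
  have hinj : Function.Injective A := fun x y h => by
    have := habs x y
    rw [h, sub_self, abs_zero] at this
    have h2 := abs_nonneg (x - y)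
    have : |x - y| = 0 := by nlinarith
    exact sub_eq_zero.1 (abs_eq_zero.1 this)
  obtain ⟨B, hAB⟩ := hsurj.hasRightInverse
  have hBA : ∀ x, B (A x) = x := fun x => hinj (hAB _)
  have hBlip : ∀ x y, |B x - B y| ≤ a₀⁻¹ * |x - y| := fun x y => by
    have := habs (B x) (B y)
    rw [hAB, hAB] at this
    rw [inv_mul_eq_div, le_div_iff₀ ha₀]
    linarith
  have hBc : Continuous B := by
    have : LipschitzWith (Real.toNNReal a₀⁻¹) B := LipschitzWith.of_dist_le_mul fun x y => by
      rw [Real.dist_eq, Real.dist_eq, Real.coe_toNNReal _ (inv_nonneg.2 ha₀.le)]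
      exact hBlip x y
    exact this.continuous
  have hpos : ∀ x, 0 < a x := fun x => ha₀.trans_le (ha_pos x)
  have hBd : ∀ y, HasDerivAt B (a (B y))⁻¹ y := fun y =>
    HasDerivAt.of_local_left_inverse hBc.continuousAt (hAd (B y)) (hpos _).ne'
      (Eventually.of_forall hAB)
  obtain ⟨Ka, hKa, hKa'⟩ := exists_bddLip_of_periodic ha ha_per
  obtain ⟨Kα, hKα, hKα'⟩ := exists_bddLip_of_periodic hα hα_per
  have haB := hKa.comp_lipschitz hBlip
  have hb := haB.inv ha₀ fun y => ha_pos (B y)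
  -- The derivative of `1 / a(B)` is `-a'(B) / a(B) ^ 3`, one factor coming from `B' = 1 / a(B)`.
  have hb' := ((hKa'.comp_lipschitz hBlip).smul (hb.smul (hb.smul hb))).neg
  have hβ := hKα.comp_lipschitz hBlip
  have hβ' := hb.smul (hKα'.comp_lipschitz hBlip)
  have hinv : BddLip lineDist (max Ka (Ka * a₀⁻¹)) fun y => ((a (B y))⁻¹)⁻¹ := by simpa only [inv_inv] using haB
  obtain ⟨K, h1, k1, k2, k3, k4, k5, k6⟩ := ((eventually_ge_atTop (1 : ℝ)).and
    ((hKa.eventually lineDist_nonneg).and ((hb.eventually lineDist_nonneg).and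
    ((hb'.eventually lineDist_nonneg).and ((hβ.eventually lineDist_nonneg).and
    ((hβ'.eventually lineDist_nonneg).and (hinv.eventually lineDist_nonneg))))))).exists
  refine ⟨K, A, B, _, _, hAd, hBd, hBA, hAB, k1, h1, fun y => inv_pos.2 (hpos _), fun y => ?_,
    fun y => ?_, k2, k3, k4, k5, k6⟩
  · have had : HasDerivAt (fun y => a (B y)) (deriv a (B y) * (a (B y))⁻¹) y :=
      ((ha.differentiable two_ne_zero) (B y)).hasDerivAt.comp y (hBd y)
    refine (had.inv (hpos _).ne').congr_deriv ?_
    have := (hpos (B y)).ne'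
    simp only [smul_eq_mul]
    field_simp
  · exact ((hα.differentiable two_ne_zero) (B y)).hasDerivAt.scomp y (hBd y)

end TwoScale

/-! ### Uniform bounds on the initial profile and the initial rate. -/

namespace TwoScale

open Set Filter Topology

noncomputable section

/-- The distance on phase space `(y, θ)` in which fast variations are weighted by `ε`. -/
def phaseDist (ε : ℝ) (p q : ℝ × ℝ) : ℝ := |p.1 - q.1| + ε * |p.2 - q.2|

theorem phaseDist_nonneg {ε : ℝ} (hε : 0 ≤ ε) (p q : ℝ × ℝ) : 0 ≤ phaseDist ε p q := by
  unfold phaseDist; positivity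

theorem BddLip.comp_fst {E : Type*} [NormedAddCommGroup E] {C ε : ℝ} (hε : 0 ≤ ε) {f : ℝ → E}
    (hf : BddLip lineDist C f) : BddLip (phaseDist ε) C fun p : ℝ × ℝ => f p.1 where
  bdd p := hf.bdd _
  lip p q := by
    have hC := (norm_nonneg _).trans (hf.bdd 0)
    refine (hf.lip _ _).trans (mul_le_mul_of_nonneg_left ?_ hC)
    have := mul_nonneg hε (abs_nonneg (p.2 - q.2))
    simp only [lineDist, phaseDist]
    linarith

/-- The prefactor `ε` supplies exactly the weight that `phaseDist ε` puts on the phase; in `y` there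
is room to spare since `ε ≤ 1`. -/
theorem BddLip.eps_smul {E : Type*} [NormedAddCommGroup E] [NormedSpace ℝ E] {C ε : ℝ}
    (hε : 0 < ε) (hε1 : ε ≤ 1) {f : ℝ × ℝ → E} (hf : BddLip (phaseDist 1) C f) :
    BddLip (phaseDist ε) C fun p => ε • f p where
  bdd p := by
    have hC := (norm_nonneg _).trans (hf.bdd 0)
    rw [norm_smul, Real.norm_of_nonneg hε.le]
    have := hf.bdd p
    nlinarith [norm_nonneg (f p)]
  lip p q := by
    have hC := (norm_nonneg _).trans (hf.bdd 0)
    rw [← smul_sub, norm_smul, Real.norm_of_nonneg hε.le]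
    refine (mul_le_mul_of_nonneg_left (hf.lip p q) hε.le).trans ?_
    rw [mul_left_comm]
    refine mul_le_mul_of_nonneg_left ?_ hC
    unfold phaseDist
    nlinarith [abs_nonneg (p.1 - q.1)]

theorem bddLip_osc {E : Type*} [NormedAddCommGroup E] [NormedSpace ℝ E] [CompleteSpace E]
    {g : ℝ → ℝ → E} {Q : ℝ} (hg : ∀ y, Continuous (g y))
    (hp : ∀ y, Function.Periodic (g y) (2 * Real.pi)) (hQ : ∀ y σ, ‖g y σ‖ ≤ Q)
    (hL : ∀ y y' σ, ‖g y σ - g y' σ‖ ≤ Q * |y - y'|) :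
    BddLip (phaseDist 1) (4 * Real.pi * Q) fun p : ℝ × ℝ => osc (g p.1) p.2 where
  bdd p := norm_osc_le (hg _) (hp _) (hQ _) _
  lip p q := by
    have hQ0 : 0 ≤ Q := (norm_nonneg _).trans (hQ 0 0)
    have h1 : ‖osc (g p.1) p.2 - osc (g q.1) p.2‖ ≤ 4 * Real.pi * (Q * |p.1 - q.1|) := by
      rw [osc_sub (hg _) (hg _)]
      exact norm_osc_le ((hg _).sub (hg _)) ((hp _).sub (hp _)) (hL _ _) _
    have h2 := norm_osc_sub_le (hg q.1) (hQ q.1) p.2 q.2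
    have h3 := norm_add_le (osc (g p.1) p.2 - osc (g q.1) p.2)
      (osc (g q.1) p.2 - osc (g q.1) q.2)
    rw [sub_add_sub_cancel] at h3
    have h4 : 2 * Q * |p.2 - q.2| ≤ 4 * Real.pi * Q * |p.2 - q.2| := by
      refine mul_le_mul_of_nonneg_right ?_ (abs_nonneg _)
      nlinarith [Real.pi_gt_three]
    unfold phaseDist
    linarith

theorem norm_exp_I_mul_sub_le (x y : ℝ) :
    ‖Complex.exp (Complex.I * x) - Complex.exp (Complex.I * y)‖ ≤ |x - y| := by
  have h := Real.norm_exp_I_mul_ofReal_sub_one_le (x := x - y)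
  have e : Complex.exp (Complex.I * x) - Complex.exp (Complex.I * y)
      = Complex.exp (Complex.I * y) * (Complex.exp (Complex.I * ((x - y : ℝ) : ℂ)) - 1) := by
    rw [mul_sub, ← Complex.exp_add, mul_one]; congr 2; push_cast; ring
  rw [e, norm_mul, norm_exp_I_mul, one_mul]
  exact h

theorem norm_exp_neg_I_mul_sub_le (x y : ℝ) :
    ‖Complex.exp (-(Complex.I * x)) - Complex.exp (-(Complex.I * y))‖ ≤ |x - y| := by
  have h := norm_exp_I_mul_sub_le (-x) (-y)
  rw [neg_sub_neg, abs_sub_comm] at h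
  simpa using h

/-- The source itself varies in the phase at order one, but an increment of it varies only in
proportion to `‖q‖`. This is where the bounded second derivative of `r` makes the initial rate
slowly varying. -/
theorem norm_source_increment_sub_le {r : ℂ → ℂ} {K : ℝ} (hr : DiffBound K r) (θ θ' : ℝ)
    (z q : ℂ) :
    ‖(source r θ (z + q) - source r θ z) - (source r θ' (z + q) - source r θ' z)‖
      ≤ K * (2 + ‖z‖) * ‖q‖ * |θ - θ'| := by
  set ω := Complex.exp (Complex.I * θ)
  set ω' := Complex.exp (Complex.I * θ')
  set η := Complex.exp (-(Complex.I * θ))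
  set η' := Complex.exp (-(Complex.I * θ'))
  have hω : ‖ω‖ = 1 := norm_exp_I_mul θ
  have hη' : ‖η'‖ = 1 := norm_exp_neg_I_mul θ'
  have hωω : ‖ω - ω'‖ ≤ |θ - θ'| := norm_exp_I_mul_sub_le θ θ'
  have hηη : ‖η - η'‖ ≤ |θ - θ'| := norm_exp_neg_I_mul_sub_le θ θ'
  have hK : 0 ≤ K := by simpa using (norm_nonneg _).trans (hr.lip 1 0)
  -- The phase is changed in one place at a time: the outer factor, the base point, the increment.
  have e : (source r θ (z + q) - source r θ z) - (source r θ' (z + q) - source r θ' z)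
      = (η - η') * (r (ω * z + ω * q) - r (ω * z))
        + η' * (((r (ω * z + ω * q) - r (ω * z)) - (r (ω' * z + ω * q) - r (ω' * z)))
          + (r (ω' * z + ω * q) - r (ω' * z + ω' * q))) := by
    simp only [source, mul_add, ω, ω', η, η']
    ring
  have h1 : ‖r (ω * z + ω * q) - r (ω * z)‖ ≤ K * ‖q‖ := by
    have := hr.lip (ω * z + ω * q) (ω * z)
    rwa [add_sub_cancel_left, norm_mul, hω, one_mul] at this
  have h2 : ‖(r (ω * z + ω * q) - r (ω * z)) - (r (ω' * z + ω * q) - r (ω' * z))‖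
      ≤ K * ‖q‖ * (|θ - θ'| * ‖z‖) := by
    have := hr.mixed (ω * z) (ω' * z) (ω * q)
    rw [← sub_mul, norm_mul, norm_mul, hω, one_mul] at this
    exact this.trans (mul_le_mul_of_nonneg_left
      (mul_le_mul_of_nonneg_right hωω (norm_nonneg _)) (by positivity))
  have h3 : ‖r (ω' * z + ω * q) - r (ω' * z + ω' * q)‖ ≤ K * (|θ - θ'| * ‖q‖) := by
    have := hr.lip (ω' * z + ω * q) (ω' * z + ω' * q)
    rw [add_sub_add_left_eq_sub, ← sub_mul, norm_mul] at this
    exact this.trans (mul_le_mul_of_nonneg_left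
      (mul_le_mul_of_nonneg_right hωω (norm_nonneg _)) hK)
  rw [e]
  refine (norm_add_le _ _).trans ?_
  rw [norm_mul, norm_mul, hη', one_mul]
  have h4 := mul_le_mul hηη h1 (norm_nonneg _) (abs_nonneg _)
  have h5 := norm_add_le ((r (ω * z + ω * q) - r (ω * z)) - (r (ω' * z + ω * q) - r (ω' * z)))
    (r (ω' * z + ω * q) - r (ω' * z + ω' * q))
  linarith

/-- As `q` is of order `ε`, changing the phase costs `ε |θ - θ'|`, which `phaseDist ε` admits.
Changing `z` and `q` at fixed phase is a plain Lipschitz estimate. -/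
theorem bddLip_source_increment {r : ℂ → ℂ} {K : ℝ} (hr : DiffBound K r) {ε Cz Cq : ℝ}
    {z q : ℝ × ℝ → ℂ} (hz : BddLip (phaseDist ε) Cz z)
    (hq : BddLip (phaseDist ε) Cq q) (hqε : ∀ p, ‖q p‖ ≤ ε * Cq) :
    BddLip (phaseDist ε) (K * ((2 + Cz) * Cq) + K * (2 * Cz + Cq))
      fun p => source r p.2 (z p + q p) - source r p.2 (z p) := by
  have hK : 0 ≤ K := by simpa using (norm_nonneg _).trans (hr.lip 1 0)
  have hCz := (norm_nonneg _).trans (hz.bdd 0)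
  have hCq := (norm_nonneg _).trans (hq.bdd 0)
  refine ⟨fun p => ?_, fun p p' => ?_⟩
  · have h := (hr.source p.2).lip (z p + q p) (z p)
    rw [add_sub_cancel_left] at h
    have h2 := mul_le_mul_of_nonneg_left (hq.bdd p) hK
    have : 0 ≤ K * ((2 + Cz) * Cq) := by positivity
    have : 0 ≤ K * (2 * Cz) := by positivity
    linarith
  · have h1 := norm_source_increment_sub_le hr p.2 p'.2 (z p) (q p)
    have h2 := (hr.source p'.2).lip (z p + q p) (z p' + q p')
    have h3 := (hr.source p'.2).lip (z p) (z p')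
    have h4 : ‖z p + q p - (z p' + q p')‖ ≤ (Cz + Cq) * phaseDist ε p p' := (hz.add hq).lip p p'
    have h5 := hz.lip p p'
    have h6 : K * (2 + ‖z p‖) * ‖q p‖ * |p.2 - p'.2|
        ≤ K * ((2 + Cz) * Cq) * phaseDist ε p p' := by
      calc K * (2 + ‖z p‖) * ‖q p‖ * |p.2 - p'.2|
          ≤ K * (2 + Cz) * (ε * Cq) * |p.2 - p'.2| := by
            gcongr
            · exact hz.bdd p
            · exact hqε p
        _ = K * ((2 + Cz) * Cq) * (ε * |p.2 - p'.2|) := by ring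
        _ ≤ _ := mul_le_mul_of_nonneg_left (by unfold phaseDist; linarith [abs_nonneg (p.1 - p'.1)])
            (by positivity)
    have e : (source r p.2 (z p + q p) - source r p.2 (z p))
          - (source r p'.2 (z p' + q p') - source r p'.2 (z p'))
        = ((source r p.2 (z p + q p) - source r p.2 (z p))
            - (source r p'.2 (z p + q p) - source r p'.2 (z p)))
          + ((source r p'.2 (z p + q p) - source r p'.2 (z p' + q p'))
            - (source r p'.2 (z p) - source r p'.2 (z p'))) := by ring
    rw [e]
    refine (norm_add_le _ _).trans ?_
    have h7 := norm_sub_le (source r p'.2 (z p + q p) - source r p'.2 (z p' + q p'))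
      (source r p'.2 (z p) - source r p'.2 (z p'))
    have h8 := mul_le_mul_of_nonneg_left h4 hK
    have h9 := mul_le_mul_of_nonneg_left h5 hK
    linarith

/-- The symmetric sum `s ↦ f (y + s) + f (y - s)` has derivative `f' (y + s) - f' (y - s)`, of norm
at most `2 C |k|` between `0` and `k`. -/
theorem norm_second_difference_le {E : Type*} [NormedAddCommGroup E] [NormedSpace ℝ E]
    {f f' : ℝ → E} {C : ℝ} (hf : ∀ y, HasDerivAt f (f' y) y)
    (hl : ∀ x y, ‖f' x - f' y‖ ≤ C * |x - y|) (y k : ℝ) :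
    ‖f (y + k) - (2 : ℝ) • f y + f (y - k)‖ ≤ 2 * C * k ^ 2 := by
  have hC : 0 ≤ C := by simpa using (norm_nonneg _).trans (hl 1 0)
  have hd : ∀ s ∈ uIcc 0 k, HasDerivWithinAt (fun s => f (y + s) + f (y - s))
      (f' (y + s) - f' (y - s)) (uIcc 0 k) s := by
    intro s _
    have h1 : HasDerivAt (fun s => f (y + s)) (f' (y + s)) s :=
      ((hf (y + s)).scomp s ((hasDerivAt_id s).const_add y)).congr_deriv (one_smul _ _)
    have h2 : HasDerivAt (fun s => f (y - s)) (-f' (y - s)) s :=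
      ((hf (y - s)).scomp s ((hasDerivAt_id s).const_sub y)).congr_deriv (by simp)
    exact ((h1.add h2).congr_deriv (sub_eq_add_neg _ _).symm).hasDerivWithinAt
  have h := (convex_uIcc 0 k).norm_image_sub_le_of_norm_hasDerivWithin_le hd
    (C := 2 * C * |k|) (fun s hs => ?_) left_mem_uIcc right_mem_uIcc
  · simp only [add_zero, sub_zero, Real.norm_eq_abs] at h
    have e : f (y + k) - (2 : ℝ) • f y + f (y - k)
        = f (y + k) + f (y - k) - (f y + f y) := by rw [two_smul]; abel
    rw [e]
    refine h.trans (le_of_eq ?_)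
    rw [mul_assoc, abs_mul_abs_self]; ring
  · refine (hl _ _).trans ?_
    have e : y + s - (y - s) = 2 * s := by ring
    have h1 : |s| ≤ |k| := by
      have := abs_sub_left_of_mem_uIcc hs
      simpa using this
    rw [e, abs_mul, abs_two]
    nlinarith

section Profile

variable {r : ℂ → ℂ} {K : ℝ} {b b' : ℝ → ℝ} {β β' : ℝ → ℂ}

/-- The fast oscillating part of the initial datum, without the factor `-ε`. -/
def fastPart (r : ℂ → ℂ) (b : ℝ → ℝ) (β : ℝ → ℂ) (p : ℝ × ℝ) : ℂ :=
  b p.1 • osc (fun σ => source r σ (β p.1)) p.2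

/-- The space derivative of `fastPart`. -/
def fastPartDeriv (r : ℂ → ℂ) (b b' : ℝ → ℝ) (β β' : ℝ → ℂ) (p : ℝ × ℝ) : ℂ :=
  b' p.1 • osc (fun σ => source r σ (β p.1)) p.2
    + b p.1 • (osc (fun σ => fderiv ℝ (source r σ) (β p.1)) p.2) (β' p.1)

/-- The initial datum in the variables `(y, θ)`. -/
def initialProfile (r : ℂ → ℂ) (b : ℝ → ℝ) (β : ℝ → ℂ) (ε : ℝ) (p : ℝ × ℝ) : ℂ :=
  β p.1 - ε • fastPart r b β p

/-- The initial value of the time derivative. -/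
def initialRate (r : ℂ → ℂ) (b b' : ℝ → ℝ) (β β' : ℝ → ℂ) (c ε : ℝ) (p : ℝ × ℝ) : ℂ :=
  -(source r p.2 (initialProfile r b β ε p) - source r p.2 (β p.1))
    - average (fun s => source r s (β p.1))
    - c • ((b p.1)⁻¹ • (β' p.1 - ε • fastPartDeriv r b b' β β' p))

theorem ClockData.bddLip_osc_source (h : ClockData K b b' β β') (hr : Continuous r)
    (hb : DiffBound K r) (h0 : ‖r 0‖ ≤ K) :
    BddLip (phaseDist 1) (4 * Real.pi * (K + K * K))
      fun p : ℝ × ℝ => osc (fun σ => source r σ (β p.1)) p.2 := by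
  have hK : 0 ≤ K := zero_le_one.trans h.one_le
  refine bddLip_osc (g := fun y σ => source r σ (β y))
    (fun y => continuous_source hr continuous_const) (fun y => source_periodic r _)
    (fun y σ => ?_) fun y y' σ => ?_
  · refine ((hb.source σ).norm_le (β y)).trans ?_
    rw [norm_source_zero]
    have := mul_le_mul_of_nonneg_left (h.β_lip.bdd y) hK
    linarith
  · refine ((hb.source σ).lip _ _).trans ?_
    have h1 : ‖β y - β y'‖ ≤ K * |y - y'| := h.β_lip.lip y y'
    have := mul_le_mul_of_nonneg_left h1 hK
    have := mul_nonneg hK (abs_nonneg (y - y'))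
    linarith

theorem ClockData.bddLip_osc_fderiv (h : ClockData K b b' β β') (hr : Differentiable ℝ r)
    (hr' : Continuous (fderiv ℝ r)) (hb : DiffBound K r) :
    BddLip (phaseDist 1) (4 * Real.pi * (K + K * K))
      fun p : ℝ × ℝ => osc (fun σ => fderiv ℝ (source r σ) (β p.1)) p.2 := by
  have hK : 0 ≤ K := zero_le_one.trans h.one_le
  refine bddLip_osc (g := fun y σ => fderiv ℝ (source r σ) (β y))
    (fun y => continuous_fderiv_source hr hr' _) (fun y => fderiv_source_periodic r _)
    (fun y σ => ?_) fun y y' σ => ?_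
  · refine ((hb.source σ).norm_fderiv_le hK (β y)).trans ?_
    nlinarith
  · refine ((hb.source σ).norm_fderiv_sub_le
      (fun z => (hasFDerivAt_source hr σ z).differentiableAt) hK _ _).trans ?_
    have h1 : ‖β y - β y'‖ ≤ K * |y - y'| := h.β_lip.lip y y'
    have := mul_le_mul_of_nonneg_left h1 hK
    have := mul_nonneg hK (abs_nonneg (y - y'))
    linarith

theorem ClockData.hasDerivAt_initialProfile (h : ClockData K b b' β β') (hr : Differentiable ℝ r)
    (hr' : Continuous (fderiv ℝ r)) (hb : DiffBound K r) (ε y θ : ℝ) :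
    HasDerivAt (fun y => initialProfile r b β ε (y, θ))
      (β' y - ε • fastPartDeriv r b b' β β' (y, θ)) y := by
  have hK : 0 ≤ K := zero_le_one.trans h.one_le
  have h1 := (hasFDerivAt_osc_source hK hr hr' hb θ (β y)).comp_hasDerivAt y (h.hβ y)
  have h2 := (h.hb y).smul h1
  have h3 := (h.hβ y).sub (h2.const_smul ε)
  refine h3.congr_deriv ?_
  simp only [fastPartDeriv, Function.comp_apply]
  rw [add_comm]

/-- Bounds on the initial profile and rate, uniform in `ε`. -/
structure ProfileBound (C ε : ℝ) (w ρ : ℝ × ℝ → ℂ) : Prop where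
  bdd : ∀ p, ‖w p‖ ≤ C
  lip : ∀ y y' θ, ‖w (y, θ) - w (y', θ)‖ ≤ C * |y - y'|
  second : ∀ y k θ, ‖w (y + k, θ) - 2 * w (y, θ) + w (y - k, θ)‖ ≤ C * k ^ 2
  rate : BddLip (phaseDist ε) C ρ

/-- No `1/ε` is left in `initialRate`. Its dependence on the phase comes through a source increment
of size `ε` and through `ε • fastPartDeriv`, both admissible for `phaseDist ε`; the average and `β'`
do not see the phase. The second-difference bound follows from the Lipschitz derivative in `y`. -/
theorem ClockData.exists_profileBound (h : ClockData K b b' β β') (hr : Differentiable ℝ r)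
    (hr' : Continuous (fderiv ℝ r)) (hb : DiffBound K r) (h0 : ‖r 0‖ ≤ K) (c : ℝ) :
    ∃ C, ∀ ε, 0 < ε → ε ≤ 1 → ProfileBound C ε (initialProfile r b β ε)
      (initialRate r b b' β β' c ε) := by
  have hK : 0 ≤ K := zero_le_one.trans h.one_le
  have hJ := h.bddLip_osc_source hr.continuous hb h0
  have hJ1 := h.bddLip_osc_fderiv hr hr' hb
  have hM : BddLip (phaseDist 1) _ (fastPart r b β) := (h.b_lip.comp_fst zero_le_one).smul hJ
  have hN : BddLip (phaseDist 1) _ (fastPartDeriv r b b' β β') :=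
    ((h.b'_lip.comp_fst zero_le_one).smul hJ).add
      ((h.b_lip.comp_fst zero_le_one).smul (hJ1.clm_apply (h.β'_lip.comp_fst zero_le_one)))
  have havg : BddLip lineDist (K + K * K) fun y => average fun s => source r s (β y) := by
    have hc : ∀ y, Continuous fun s => source r s (β y) := fun y =>
      continuous_source hr.continuous continuous_const
    refine ⟨fun y => ?_, fun y y' => ?_⟩
    · rw [average_eq]
      refine norm_mean_le fun σ => ((hb.source σ).norm_le (β y)).trans ?_
      rw [norm_source_zero]
      have := mul_le_mul_of_nonneg_left (h.β_lip.bdd y) hK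
      linarith
    · rw [average_eq, average_eq, ← smul_sub,
        ← intervalIntegral.integral_sub ((hc y).intervalIntegrable _ _)
          ((hc y').intervalIntegrable _ _)]
      refine norm_mean_le fun σ => ((hb.source σ).lip _ _).trans ?_
      have := mul_le_mul_of_nonneg_left (h.β_lip.lip y y') hK
      have := mul_nonneg hK (lineDist_nonneg y y')
      linarith
  obtain ⟨CM, hM⟩ : ∃ CM, BddLip (phaseDist 1) CM (fastPart r b β) := ⟨_, hM⟩
  obtain ⟨CN, hN⟩ : ∃ CN, BddLip (phaseDist 1) CN (fastPartDeriv r b b' β β') := ⟨_, hN⟩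
  have key : ∃ C1 C2 C3, ∀ ε, 0 < ε → ε ≤ 1 →
      BddLip (phaseDist ε) C1 (initialProfile r b β ε) ∧
      BddLip (phaseDist ε) C2 (fun p => β' p.1 - ε • fastPartDeriv r b b' β β' p) ∧
      BddLip (phaseDist ε) C3 (initialRate r b b' β β' c ε) := by
    refine ⟨K + CM, K + CN, K * ((2 + K) * CM) + K * (2 * K + CM) + (K + K * K)
      + 2 * (‖c‖ * (2 * (K * (K + CN)))), fun ε hε hε1 => ?_⟩
    have hd := (h.β'_lip.comp_fst hε.le).sub (hN.eps_smul hε hε1)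
    have hq : ∀ p, ‖-(ε • fastPart r b β p)‖ ≤ ε * CM := fun p => by
      rw [norm_neg, norm_smul, Real.norm_of_nonneg hε.le]
      exact mul_le_mul_of_nonneg_left (hM.bdd p) hε.le
    have hinc := bddLip_source_increment hb (h.β_lip.comp_fst hε.le)
      (hM.eps_smul hε hε1).neg hq
    simp only [← sub_eq_add_neg] at hinc
    exact ⟨(h.β_lip.comp_fst hε.le).sub (hM.eps_smul hε hε1), hd,
      ((hinc.neg.sub (havg.comp_fst hε.le)).sub
        ((BddLip.const _ (phaseDist_nonneg hε.le) c).smul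
          ((h.inv_lip.comp_fst hε.le).smul hd)))⟩
  obtain ⟨C1, C2, C3, key⟩ := key
  -- The instance `ε = 1` serves only to show that the three constants are nonnegative.
  have hnn := key 1 one_pos le_rfl
  have n1 := (norm_nonneg _).trans (hnn.1.bdd 0)
  have n2 := (norm_nonneg _).trans (hnn.2.1.bdd 0)
  have n3 := (norm_nonneg _).trans (hnn.2.2.bdd 0)
  refine ⟨C1 + 2 * C2 + C3, fun ε hε hε1 => ?_⟩
  obtain ⟨k1, k2, k3⟩ := key ε hε hε1
  refine ⟨fun p => (k1.bdd p).trans (by linarith), fun y y' θ => ?_, fun y k θ => ?_,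
    k3.mono (by linarith) (phaseDist_nonneg hε.le)⟩
  · have := k1.lip (y, θ) (y', θ)
    simp only [phaseDist, sub_self, abs_zero, mul_zero, add_zero] at this
    refine this.trans (mul_le_mul_of_nonneg_right (by linarith) (abs_nonneg _))
  · have := norm_second_difference_le (C := C2)
      (fun y => h.hasDerivAt_initialProfile hr hr' hb ε y θ)
      (fun x y => by
        have := k2.lip (x, θ) (y, θ)
        simpa only [phaseDist, sub_self, abs_zero, mul_zero, add_zero] using this) y k
    rw [Complex.real_smul, Complex.ofReal_ofNat] at this
    exact this.trans (mul_le_mul_of_nonneg_right (by linarith) (sq_nonneg _))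

end Profile

end

end TwoScale

/-! ### Characteristics and the expansion at the initial time. -/

namespace TwoScale

open Set Filter Topology

noncomputable section

/-- The time elapsed along a characteristic issued from `Y`. -/
def travel (b : ℝ → ℝ) (c Y s : ℝ) : ℝ := ∫ σ in (0 : ℝ)..s, b (Y + c * σ)

section Travel

variable {b : ℝ → ℝ} {c K : ℝ}

theorem hasDerivAt_travel (hb : Continuous b) (Y s : ℝ) :
    HasDerivAt (travel b c Y) (b (Y + c * s)) s := by
  have hc : Continuous fun σ => b (Y + c * σ) := by fun_prop
  exact intervalIntegral.integral_hasDerivAt_right (hc.intervalIntegrable _ _)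
    hc.aestronglyMeasurable.stronglyMeasurableAtFilter hc.continuousAt

theorem travel_zero (b : ℝ → ℝ) (c Y : ℝ) : travel b c Y 0 = 0 := by simp [travel]

theorem travel_mono (hb : Continuous b) (hpos : ∀ y, 0 < b y) (Y : ℝ) :
    Monotone (travel b c Y) :=
  monotone_of_deriv_nonneg (fun s => (hasDerivAt_travel hb Y s).differentiableAt) fun s => by
    rw [(hasDerivAt_travel hb Y s).deriv]; exact (hpos _).le

theorem le_travel (hb : Continuous b) {m : ℝ} (hm : ∀ y, m ≤ b y) {s : ℝ} (hs : 0 ≤ s) (Y : ℝ) :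
    m * s ≤ travel b c Y s := by
  have hc : Continuous fun σ => b (Y + c * σ) := by fun_prop
  have := intervalIntegral.integral_mono_on hs (continuous_const (y := m).intervalIntegrable
    (μ := MeasureTheory.volume) 0 s) (hc.intervalIntegrable 0 s) fun x _ => hm _
  simpa [travel, mul_comm] using this

/-- Anchored at its end point `y`, the travel time becomes a primitive in `S`, hence continuous in
`S`. -/
theorem travel_sub_mul (b : ℝ → ℝ) (c y S : ℝ) :
    travel b c (y - c * S) S = ∫ σ in (0 : ℝ)..S, b (y - c * σ) := by
  have := intervalIntegral.integral_comp_sub_left (a := 0) (b := S) (fun σ => b (y - c * σ)) S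
  rw [sub_self, sub_zero] at this
  rw [← this, travel]
  congr 1; ext σ; congr 1; ring

theorem abs_travel_sub_le (hb : Continuous b) (hl : BddLip lineDist K b) {s : ℝ} (hs : 0 ≤ s)
    (Y Y' : ℝ) : |travel b c Y s - travel b c Y' s| ≤ K * s * |Y - Y'| := by
  have hc : ∀ Y, Continuous fun σ => b (Y + c * σ) := fun Y => by fun_prop
  rw [travel, travel, ← intervalIntegral.integral_sub ((hc Y).intervalIntegrable _ _)
    ((hc Y').intervalIntegrable _ _)]
  have := intervalIntegral.norm_integral_le_of_norm_le_const (a := 0) (b := s)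
    (f := fun σ => b (Y + c * σ) - b (Y' + c * σ)) (C := K * |Y - Y'|) fun σ _ => by
      have := hl.lip (Y + c * σ) (Y' + c * σ)
      rwa [lineDist, add_sub_add_right_eq_sub] at this
  rw [sub_zero, abs_of_nonneg hs] at this
  rw [← Real.norm_eq_abs]
  linarith

theorem abs_travel_second_le (hb : Continuous b)
    (h2 : ∀ y k, |b (y + k) - 2 * b y + b (y - k)| ≤ 2 * K * k ^ 2) {s : ℝ} (hs : 0 ≤ s)
    (Y k : ℝ) :
    |travel b c (Y + k) s - 2 * travel b c Y s + travel b c (Y - k) s| ≤ 2 * K * s * k ^ 2 := by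
  have hc : ∀ Y, Continuous fun σ => b (Y + c * σ) := fun Y => by fun_prop
  have e : travel b c (Y + k) s - 2 * travel b c Y s + travel b c (Y - k) s
      = ∫ σ in (0 : ℝ)..s, (b (Y + k + c * σ) - 2 * b (Y + c * σ) + b (Y - k + c * σ)) := by
    have hc2 : Continuous fun σ => b (Y + k + c * σ) - 2 * b (Y + c * σ) := by fun_prop
    rw [intervalIntegral.integral_add (hc2.intervalIntegrable _ _)
      ((hc _).intervalIntegrable _ _), intervalIntegral.integral_sub
      ((hc _).intervalIntegrable _ _) (((hc _).const_mul 2).intervalIntegrable _ _),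
      intervalIntegral.integral_const_mul]
    rfl
  have := intervalIntegral.norm_integral_le_of_norm_le_const (a := 0) (b := s)
    (f := fun σ => b (Y + k + c * σ) - 2 * b (Y + c * σ) + b (Y - k + c * σ))
    (C := 2 * K * k ^ 2) fun σ _ => by
      have := h2 (Y + c * σ) k
      rwa [add_right_comm, ← sub_add_eq_add_sub] at this
  rw [sub_zero, abs_of_nonneg hs] at this
  rw [e, ← Real.norm_eq_abs]
  linarith

end Travel

variable {r : ℂ → ℂ} {K C c T ε : ℝ} {b b' : ℝ → ℝ} {β β' : ℝ → ℂ} {w ρ : ℝ × ℝ → ℂ}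
  {W : ℝ → ℝ → ℝ → ℂ}

theorem ClockData.continuous (h : ClockData K b b' β β') : Continuous b :=
  continuous_iff_continuousAt.2 fun y => (h.hb y).continuousAt

theorem ClockData.inv_le (h : ClockData K b b' β β') (y : ℝ) : K⁻¹ ≤ b y := by
  have := h.inv_lip.bdd y
  rw [norm_inv, Real.norm_of_nonneg (h.b_pos y).le] at this
  exact inv_le_of_inv_le₀ (h.b_pos y) this

theorem ClockData.le_mul_travel (h : ClockData K b b' β β') {s : ℝ} (hs : 0 ≤ s) (Y : ℝ) :
    s ≤ K * travel b c Y s := by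
  have hK : 0 < K := zero_lt_one.trans_le h.one_le
  have := le_travel (c := c) h.continuous h.inv_le hs Y
  rwa [inv_mul_le_iff₀ hK] at this

/-- `W` is the solution in the variables `(t, y, θ)`, described along characteristics. -/
structure IsProfile (r : ℂ → ℂ) (b : ℝ → ℝ) (c T ε : ℝ) (w ρ : ℝ × ℝ → ℂ)
    (W : ℝ → ℝ → ℝ → ℂ) : Prop where
  start : ∀ y θ, W 0 y θ = w (y, θ)
  start_along : ∀ Y θ s, HasDerivAt (fun s => w (Y + c * s, θ + s / ε))
    (-(b (Y + c * s) • (source r (θ + s / ε) (w (Y + c * s, θ + s / ε))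
      + ρ (Y + c * s, θ + s / ε)))) s
  along : ∀ q Y θ S, 0 ≤ q → q + travel b c Y S ≤ T → ∀ s ∈ Icc 0 S,
    HasDerivWithinAt (fun s => W (q + travel b c Y s) (Y + c * s) (θ + s / ε))
      (-(b (Y + c * s) • source r (θ + s / ε)
        (W (q + travel b c Y s) (Y + c * s) (θ + s / ε)))) (Icc 0 S) s

/-- Three points can be moved back along characteristics by a common amount until the first of
them reaches the initial time. -/
theorem ClockData.exists_common_start (h : ClockData K b b' β β') (c : ℝ) {t₁ t₂ t₃ : ℝ}
    (h₁ : t₁ ∈ Icc 0 T) (h₂ : t₂ ∈ Icc 0 T) (h₃ : t₃ ∈ Icc 0 T) (y₁ y₂ y₃ : ℝ) :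
    ∃ S ∈ Icc 0 (K * T), ∃ q₁ q₂ q₃ : ℝ, 0 ≤ q₁ ∧ 0 ≤ q₂ ∧ 0 ≤ q₃ ∧
      (q₁ = 0 ∨ q₂ = 0 ∨ q₃ = 0) ∧ q₁ + travel b c (y₁ - c * S) S = t₁ ∧
      q₂ + travel b c (y₂ - c * S) S = t₂ ∧ q₃ + travel b c (y₃ - c * S) S = t₃ := by
  have hK : 0 < K := zero_lt_one.trans_le h.one_le
  have hT : 0 ≤ T := h₁.1.trans h₁.2
  have hc : ∀ y, Continuous fun S => travel b c (y - c * S) S := fun y => by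
    simp only [travel_sub_mul]
    have : Continuous fun σ => b (y - c * σ) := by have := h.continuous; fun_prop
    exact intervalIntegral.continuous_primitive (fun _ _ => this.intervalIntegrable _ _) 0
  -- The smallest of the remaining times. It is nonpositive at `S = K * T` because the clock runs at
  -- rate at least `K⁻¹`; the intermediate value theorem supplies a zero.
  set m : ℝ → ℝ := fun S => min (min (t₁ - travel b c (y₁ - c * S) S)
    (t₂ - travel b c (y₂ - c * S) S)) (t₃ - travel b c (y₃ - c * S) S) with hm
  have hmc : Continuous m := ((continuous_const.sub (hc y₁)).min
    (continuous_const.sub (hc y₂))).min (continuous_const.sub (hc y₃))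
  have hm0 : 0 ≤ m 0 := by
    simp only [hm, travel_zero, sub_zero]
    exact le_min (le_min h₁.1 h₂.1) h₃.1
  have hmT : m (K * T) ≤ 0 := by
    refine (min_le_left _ _).trans ((min_le_left _ _).trans ?_)
    have := h.le_mul_travel (c := c) (mul_nonneg hK.le hT) (y₁ - c * (K * T))
    have := le_of_mul_le_mul_left this hK
    linarith [h₁.2]
  obtain ⟨S, hS, hS0⟩ := intermediate_value_Icc' (mul_nonneg hK.le hT) hmc.continuousOn ⟨hmT, hm0⟩
  have l1 : m S ≤ t₁ - travel b c (y₁ - c * S) S := (min_le_left _ _).trans (min_le_left _ _)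
  have l2 : m S ≤ t₂ - travel b c (y₂ - c * S) S := (min_le_left _ _).trans (min_le_right _ _)
  have l3 : m S ≤ t₃ - travel b c (y₃ - c * S) S := min_le_right _ _
  rw [hS0] at l1 l2 l3
  refine ⟨S, hS, _, _, _, l1, l2, l3, ?_, sub_add_cancel _ _, sub_add_cancel _ _,
    sub_add_cancel _ _⟩
  rcases min_choice (min (t₁ - travel b c (y₁ - c * S) S)
    (t₂ - travel b c (y₂ - c * S) S)) (t₃ - travel b c (y₃ - c * S) S) with e | e
  · rcases min_choice (t₁ - travel b c (y₁ - c * S) S)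
      (t₂ - travel b c (y₂ - c * S) S) with e' | e'
    · left; rw [← e', ← e]; exact hS0
    · right; left; rw [← e', ← e]; exact hS0
  · right; right; rw [← e]; exact hS0

/-- Along the characteristic that ends at `(t, y, θ)`, `w` solves the same equation as `W` up to the
forcing `b ρ`, so Grönwall gives a difference of order `t`. Freezing `ρ` at the end point costs its
variation over a phase distance at most `(c + 1) S`: the phase moves by up to `S / ε`, but is
weighted by `ε`. Integrating once more gives order `t ^ 2`. -/
theorem IsProfile.norm_sub_initial_le (h : ClockData K b b' β β') (hb : DiffBound K r)
    (hc : 0 ≤ c) (hε : 0 < ε) (hP : ProfileBound C ε w ρ) (hW : IsProfile r b c T ε w ρ W)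
    {t : ℝ} (ht : t ∈ Icc 0 T) (y θ : ℝ) :
    ‖W t y θ - w (y, θ)‖ ≤ K * C * K * Real.exp (K * K * (K * T)) * t ∧
    ‖W t y θ - w (y, θ) - t • ρ (y, θ)‖
      ≤ (K * K * (K * C * Real.exp (K * K * (K * T))) + K * C * (c + 1)) * K ^ 2 * t ^ 2 := by
  have hK : 0 < K := zero_lt_one.trans_le h.one_le
  have hC : 0 ≤ C := (norm_nonneg _).trans (hP.bdd 0)
  have ht0 := ht.1
  obtain ⟨S, hS, q, q', q'', hq, -, -, hq0, e, e', e''⟩ := h.exists_common_start c ht ht ht y y y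
  have hq0 : q = 0 := by
    rcases hq0 with hq0 | hq0 | hq0
    · exact hq0
    all_goals linarith
  subst hq0
  rw [zero_add] at e
  have hSt : S ≤ K * t := by
    have := h.le_mul_travel (c := c) hS.1 (y - c * S)
    rwa [e] at this
  set Y := y - c * S with hY
  set θ0 := θ - S / ε with hθ0
  have eY : Y + c * S = y := by rw [hY]; ring
  have eθ : θ0 + S / ε = θ := by rw [hθ0]; ring
  set u : ℝ → ℂ := fun s => W (0 + travel b c Y s) (Y + c * s) (θ0 + s / ε) with hu
  set v : ℝ → ℂ := fun s => w (Y + c * s, θ0 + s / ε) with hv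
  set p : ℝ → ℂ := fun s => ρ (Y + c * s, θ0 + s / ε) with hp
  have huS : u S = W t y θ := by simp only [hu]; rw [e, eY, eθ, zero_add]
  have hvS : v S = w (y, θ) := by simp only [hv]; rw [eY, eθ]
  have hu0 : u 0 = v 0 := by
    simp only [hu, hv, travel_zero, mul_zero, add_zero, zero_div]; exact hW.start _ _
  have hud := hW.along 0 Y θ0 S le_rfl (by rw [zero_add, e]; exact ht.2)
  have hvd := fun s => hW.start_along Y θ0 s
  have hf : ∀ s ∈ Icc 0 S, HasDerivWithinAt (fun s => u s - v s)
      (-(b (Y + c * s) • (source r (θ0 + s / ε) (u s) - source r (θ0 + s / ε) (v s)))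
        + b (Y + c * s) • p s) (Icc 0 S) s := fun s hs => by
    refine ((hud s hs).sub (hvd s).hasDerivWithinAt).congr_deriv ?_
    simp only [hu, hv, hp, smul_add, smul_sub]
    abel
  have hbK : ∀ y, b y ≤ K := fun y => (le_abs_self _).trans (h.b_lip.bdd y)
  have hs1 : ∀ s, ‖-(b (Y + c * s) • (source r (θ0 + s / ε) (u s)
      - source r (θ0 + s / ε) (v s)))‖ ≤ K * K * ‖u s - v s‖ := fun s => by
    rw [norm_neg, norm_smul, Real.norm_of_nonneg (h.b_pos _).le, mul_assoc]
    exact mul_le_mul (hbK _) ((hb.source _).lip _ _) (norm_nonneg _) hK.le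
  have hfb := norm_le_of_norm_deriv_le (K := K * K) (E := K * C) (δ := 0) (by positivity)
    (by positivity) hf (by simp [hu0]) fun s _ => by
      refine (norm_add_le _ _).trans (add_le_add (hs1 s) ?_)
      rw [norm_smul, Real.norm_of_nonneg (h.b_pos _).le]
      exact mul_le_mul (hbK _) (hP.rate.bdd _) (norm_nonneg _) hK.le
  have hexp : ∀ s, s ≤ S → Real.exp (K * K * s) ≤ Real.exp (K * K * (K * T)) := fun s hs =>
    Real.exp_le_exp.2 (mul_le_mul_of_nonneg_left (hs.trans hS.2) (by positivity))
  set X := Real.exp (K * K * (K * T)) with hX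
  have hX0 : 0 ≤ X := (Real.exp_pos _).le
  have hfb' : ∀ s ∈ Icc 0 S, ‖u s - v s‖ ≤ K * C * X * S := fun s hs => by
    refine (hfb s hs).trans ?_
    rw [zero_add]
    calc K * C * s * Real.exp (K * K * s) ≤ K * C * S * X := by
          have := hS.1
          exact mul_le_mul (mul_le_mul_of_nonneg_left hs.2 (by positivity)) (hexp s hs.2)
            (Real.exp_pos _).le (by positivity)
      _ = _ := by ring
  have hSmem : S ∈ Icc 0 S := ⟨hS.1, le_rfl⟩
  constructor
  · have := hfb' S hSmem
    rw [huS, hvS] at this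
    refine this.trans ?_
    have := mul_le_mul_of_nonneg_left hSt (show 0 ≤ K * C * X by positivity)
    linarith
  · have hg : ∀ s ∈ Icc 0 S, HasDerivWithinAt
        (fun s => (u s - v s) - travel b c Y s • ρ (y, θ))
        (-(b (Y + c * s) • (source r (θ0 + s / ε) (u s) - source r (θ0 + s / ε) (v s)))
          + b (Y + c * s) • p s - b (Y + c * s) • ρ (y, θ)) (Icc 0 S) s := fun s hs =>
      (hf s hs).sub
        (((hasDerivAt_travel h.continuous Y s).smul_const (ρ (y, θ))).hasDerivWithinAt)
    have hgb := norm_le_of_norm_deriv_le (K := 0)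
      (E := (K * K * (K * C * X) + K * C * (c + 1)) * S) (δ := 0) le_rfl
      (by have := hS.1; positivity) hg (by simp [hu0, travel_zero]) (fun s hs => by
        rw [add_sub_assoc, ← smul_sub, zero_mul, zero_add]
        refine (norm_add_le _ _).trans ?_
        have h1 := mul_le_mul_of_nonneg_left (hfb' s hs) (show 0 ≤ K * K by positivity)
        have h2 : ‖b (Y + c * s) • (p s - ρ (y, θ))‖ ≤ K * (C * ((c + 1) * S)) := by
          rw [norm_smul, Real.norm_of_nonneg (h.b_pos _).le]
          refine mul_le_mul (hbK _) ((hP.rate.lip _ _).trans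
            (mul_le_mul_of_nonneg_left ?_ hC)) (norm_nonneg _) hK.le
          simp only [phaseDist]
          have e1 : Y + c * s - y = c * (s - S) := by rw [hY]; ring
          have e2 : θ0 + s / ε - θ = (s - S) / ε := by rw [hθ0]; ring
          rw [e1, e2, abs_mul, abs_div, abs_of_nonneg hc, abs_of_pos hε,
            mul_div_cancel₀ _ hε.ne']
          have : |s - S| ≤ S := by rw [abs_le]; constructor <;> linarith [hs.1, hs.2]
          nlinarith
        have := hs1 s
        linarith) S hSmem
    rw [zero_mul, Real.exp_zero, mul_one, zero_add, e, huS, hvS] at hgb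
    refine hgb.trans ?_
    have hSS : S * S ≤ (K * t) * (K * t) := mul_le_mul hSt hSt hS.1 (by positivity)
    have := mul_le_mul_of_nonneg_left hSS
      (show 0 ≤ K * K * (K * C * X) + K * C * (c + 1) by positivity)
    linarith

end

end TwoScale

/-! ### First differences, uniformly in `ε`. -/

namespace TwoScale

open Set Filter Topology

variable {r : ℂ → ℂ} {K C c T : ℝ} {b b' : ℝ → ℝ} {β β' : ℝ → ℂ}

/-- Constants for which the solution is bounded and close to its first-order expansion in time. -/
theorem ClockData.exists_initial_expansion (h : ClockData K b b' β β') (hb : DiffBound K r)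
    (hc : 0 ≤ c) (T : ℝ) (hC : 0 ≤ C) :
    ∃ D, 0 ≤ D ∧ ∀ (ε : ℝ) (w ρ : ℝ × ℝ → ℂ) (W : ℝ → ℝ → ℝ → ℂ), 0 < ε →
      ProfileBound C ε w ρ → IsProfile r b c T ε w ρ W → ∀ t ∈ Icc 0 T, ∀ y θ,
        ‖W t y θ‖ ≤ D ∧ ‖W t y θ - w (y, θ)‖ ≤ D * t ∧
        ‖W t y θ - w (y, θ) - t • ρ (y, θ)‖ ≤ D * t ^ 2 := by
  have hK : 0 < K := zero_lt_one.trans_le h.one_le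
  set D₁ := K * C * K * Real.exp (K * K * (K * T)) with hD₁
  set D₂ := (K * K * (K * C * Real.exp (K * K * (K * T))) + K * C * (c + 1)) * K ^ 2 with hD₂
  have h1 : 0 ≤ D₁ := by positivity
  have h2 : 0 ≤ D₂ := by positivity
  refine ⟨C + D₁ * |T| + D₁ + D₂, by positivity, fun ε w ρ W hε hP hW t ht y θ => ?_⟩
  obtain ⟨k1, k2⟩ := hW.norm_sub_initial_le h hb hc hε hP ht y θ
  have ht0 := ht.1
  have hTT : T ≤ |T| := le_abs_self T
  have hp : 0 ≤ D₁ * |T| := by positivity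
  refine ⟨?_, k1.trans (mul_le_mul_of_nonneg_right ?_ ht0),
    k2.trans (mul_le_mul_of_nonneg_right ?_ (sq_nonneg t))⟩
  · have e := norm_add_le (W t y θ - w (y, θ)) (w (y, θ))
    rw [sub_add_cancel] at e
    have := hP.bdd (y, θ)
    have := mul_le_mul_of_nonneg_left (ht.2.trans hTT) h1
    linarith
  · linarith
  · linarith

/-- Moved back by a common parameter, the two points share the phase and keep the gap `y₁ - y₂`, so
sources are compared at one phase and Grönwall applies. At the start, the times left are small and
the first-order initial estimate takes over. -/
theorem ClockData.exists_first_difference (h : ClockData K b b' β β') (hb : DiffBound K r)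
    (h0 : ‖r 0‖ ≤ K) (hc : 0 ≤ c) (hT : 0 ≤ T) (hC : 0 ≤ C) :
    ∃ D, 0 ≤ D ∧ ∀ (ε : ℝ) (w ρ : ℝ × ℝ → ℂ) (W : ℝ → ℝ → ℝ → ℂ), 0 < ε →
      ProfileBound C ε w ρ → IsProfile r b c T ε w ρ W → ∀ t₁ ∈ Icc 0 T, ∀ t₂ ∈ Icc 0 T,
        ∀ y₁ y₂ θ, ‖W t₁ y₁ θ - W t₂ y₂ θ‖ ≤ D * (|t₁ - t₂| + |y₁ - y₂|) := by
  have hK : 0 < K := zero_lt_one.trans_le h.one_le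
  obtain ⟨A, hA, hinit⟩ := h.exists_initial_expansion hb hc T hC
  set G := 1 + K * (K * T) with hG
  have hG0 : 0 ≤ G := by positivity
  refine ⟨(A * G + C + K * (K + K * A) * (K * T)) * Real.exp (K * K * (K * T)), by positivity,
    fun ε w ρ W hε hP hW t₁ ht₁ t₂ ht₂ y₁ y₂ θ => ?_⟩
  obtain ⟨S, hS, q₁, q₂, q₃, hq₁, hq₂, hq₃, hq0, e₁, e₂, e₃⟩ :=
    h.exists_common_start c ht₁ ht₂ ht₂ y₁ y₂ y₂
  have hq0 : q₁ = 0 ∨ q₂ = 0 := by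
    rcases hq0 with h | h | h
    · exact Or.inl h
    · exact Or.inr h
    · right; linarith
  have hbK : ∀ y, b y ≤ K := fun y => (le_abs_self _).trans (h.b_lip.bdd y)
  set Y₁ := y₁ - c * S with hY₁
  set Y₂ := y₂ - c * S with hY₂
  set θ0 := θ - S / ε with hθ0
  set m := |t₁ - t₂| + |y₁ - y₂| with hm
  have hYY : Y₁ - Y₂ = y₁ - y₂ := by rw [hY₁, hY₂]; ring
  have hkm : |y₁ - y₂| ≤ m := by rw [hm]; linarith [abs_nonneg (t₁ - t₂)]
  have hm0 : 0 ≤ m := (abs_nonneg _).trans hkm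
  -- One of the two times is zero, so their sum is their gap: the original time gap plus the drift
  -- of two clocks at distance `|y₁ - y₂|`.
  have hqq : q₁ + q₂ ≤ G * m := by
    have h1 : q₁ + q₂ ≤ |q₁ - q₂| := by
      rcases hq0 with e | e
      · rw [e, abs_sub_comm, sub_zero]; linarith [le_abs_self q₂]
      · rw [e, sub_zero]; linarith [le_abs_self q₁]
    have h2 : q₁ - q₂ = (t₁ - t₂) - (travel b c Y₁ S - travel b c Y₂ S) := by
      rw [← e₁, ← e₂]; ring
    have h3 := abs_travel_sub_le (c := c) h.continuous h.b_lip hS.1 Y₁ Y₂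
    rw [hYY] at h3
    have h4 := abs_sub (t₁ - t₂) (travel b c Y₁ S - travel b c Y₂ S)
    rw [← h2] at h4
    have h5 : K * S * |y₁ - y₂| ≤ K * (K * T) * m := by
      have := hS.1
      exact mul_le_mul (mul_le_mul_of_nonneg_left hS.2 hK.le) hkm (abs_nonneg _) (by positivity)
    have : |t₁ - t₂| ≤ m := by rw [hm]; linarith [abs_nonneg (y₁ - y₂)]
    rw [hG, add_mul, one_mul]
    linarith
  have htr : ∀ Y, 0 ≤ travel b c Y S := fun Y => by
    have := travel_mono (c := c) h.continuous h.b_pos Y hS.1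
    rwa [travel_zero] at this
  have hmem : ∀ q Y t, 0 ≤ q → t ∈ Icc 0 T → q + travel b c Y S = t → ∀ s ∈ Icc 0 S,
      q + travel b c Y s ∈ Icc 0 T := fun q Y t hq ht e s hs => by
    have k1 := travel_mono (c := c) h.continuous h.b_pos Y hs.1
    have k2 := travel_mono (c := c) h.continuous h.b_pos Y hs.2
    rw [travel_zero] at k1
    exact ⟨by linarith, by linarith [ht.2]⟩
  have hsrc : ∀ t ∈ Icc 0 T, ∀ y θ σ, ‖source r σ (W t y θ)‖ ≤ K + K * A := fun t ht y θ σ => by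
    refine ((hb.source σ).norm_le _).trans ?_
    rw [norm_source_zero]
    have := mul_le_mul_of_nonneg_left (hinit ε w ρ W hε hP hW t ht y θ).1 hK.le
    linarith
  have hd₁ := hW.along q₁ Y₁ θ0 S hq₁ (by rw [e₁]; exact ht₁.2)
  have hd₂ := hW.along q₂ Y₂ θ0 S hq₂ (by rw [e₂]; exact ht₂.2)
  have hgr := norm_le_of_norm_deriv_le (K := K * K) (E := K * (K + K * A) * m)
    (δ := (A * G + C) * m) (by positivity) (by positivity)
    (fun s hs => (hd₁ s hs).sub (hd₂ s hs)) ?_ ?_ S ⟨hS.1, le_rfl⟩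
  · have eY₁ : Y₁ + c * S = y₁ := by rw [hY₁]; ring
    have eY₂ : Y₂ + c * S = y₂ := by rw [hY₂]; ring
    have eθ : θ0 + S / ε = θ := by rw [hθ0]; ring
    simp only [Pi.sub_apply, e₁, e₂, eY₁, eY₂, eθ] at hgr
    refine hgr.trans ?_
    have hx : Real.exp (K * K * S) ≤ Real.exp (K * K * (K * T)) :=
      Real.exp_le_exp.2 (mul_le_mul_of_nonneg_left hS.2 (by positivity))
    have hE := mul_le_mul_of_nonneg_left hS.2 (show 0 ≤ K * (K + K * A) * m by positivity)
    have hS0 := hS.1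
    calc _ ≤ ((A * G + C) * m + K * (K + K * A) * m * (K * T))
          * Real.exp (K * K * (K * T)) :=
          mul_le_mul (by linarith) hx (Real.exp_pos _).le (by positivity)
      _ = _ := by ring
  · simp only [Pi.sub_apply, travel_zero, mul_zero, add_zero, zero_div]
    have a1 := (hinit ε w ρ W hε hP hW q₁ ⟨hq₁, by linarith [htr Y₁, ht₁.2]⟩ Y₁ θ0).2.1
    have a2 := (hinit ε w ρ W hε hP hW q₂ ⟨hq₂, by linarith [htr Y₂, ht₂.2]⟩ Y₂ θ0).2.1
    have a3 := hP.lip Y₁ Y₂ θ0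
    rw [hYY] at a3
    have e : W q₁ Y₁ θ0 - W q₂ Y₂ θ0 = (W q₁ Y₁ θ0 - w (Y₁, θ0))
        - (W q₂ Y₂ θ0 - w (Y₂, θ0)) + (w (Y₁, θ0) - w (Y₂, θ0)) := by ring
    rw [e]
    refine (norm_add_le _ _).trans ?_
    have a4 := norm_sub_le (W q₁ Y₁ θ0 - w (Y₁, θ0)) (W q₂ Y₂ θ0 - w (Y₂, θ0))
    have a5 := mul_le_mul_of_nonneg_left hqq hA
    have a6 := mul_le_mul_of_nonneg_left hkm hC
    linarith
  · intro s hs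
    simp only [Pi.sub_apply]
    have m₂ := hmem q₂ Y₂ t₂ hq₂ ht₂ e₂ s hs
    set u₁ := W (q₁ + travel b c Y₁ s) (Y₁ + c * s) (θ0 + s / ε)
    set u₂ := W (q₂ + travel b c Y₂ s) (Y₂ + c * s) (θ0 + s / ε) with hu₂
    have e : -(b (Y₁ + c * s) • source r (θ0 + s / ε) u₁)
          - -(b (Y₂ + c * s) • source r (θ0 + s / ε) u₂)
        = -(b (Y₁ + c * s) • (source r (θ0 + s / ε) u₁ - source r (θ0 + s / ε) u₂)
          + (b (Y₁ + c * s) - b (Y₂ + c * s)) • source r (θ0 + s / ε) u₂) := by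
      rw [smul_sub, sub_smul]; abel
    rw [e, norm_neg]
    refine (norm_add_le _ _).trans ?_
    rw [norm_smul, norm_smul, Real.norm_of_nonneg (h.b_pos _).le]
    have b1 := mul_le_mul (hbK (Y₁ + c * s)) ((hb.source (θ0 + s / ε)).lip u₁ u₂)
      (norm_nonneg _) hK.le
    have b2 : ‖b (Y₁ + c * s) - b (Y₂ + c * s)‖ ≤ K * m := by
      refine (h.b_lip.lip _ _).trans (mul_le_mul_of_nonneg_left ?_ hK.le)
      rw [lineDist, add_sub_add_right_eq_sub, hYY]
      exact hkm
    have b3 := mul_le_mul b2 (hsrc _ m₂ (Y₂ + c * s) (θ0 + s / ε) (θ0 + s / ε)) (norm_nonneg _)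
      (by positivity)
    rw [← hu₂] at b3
    linarith

end TwoScale

/-! ### Second differences, uniformly in `ε`. -/

namespace TwoScale

open Set Filter Topology

variable {r : ℂ → ℂ} {K C c T : ℝ} {b b' : ℝ → ℝ} {β β' : ℝ → ℂ}

theorem ClockData.abs_second_le (h : ClockData K b b' β β') (y k : ℝ) :
    |b (y + k) - 2 * b y + b (y - k)| ≤ 2 * K * k ^ 2 :=
  norm_second_difference_le h.hb (fun x y => h.b'_lip.lip x y) y k

/-- The second difference of the product of a clock and a source. -/
theorem norm_second_difference_smul_le {b₁ b₂ b₃ κ L M m D : ℝ} {s₁ s₂ s₃ : ℂ} (hκ : 0 ≤ κ)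
    (hm : 0 ≤ m)
    (hb₂ : |b₂| ≤ κ) (h₁₂ : |b₁ - b₂| ≤ κ * m) (h₃₂ : |b₃ - b₂| ≤ κ * m)
    (hb : |b₁ - 2 * b₂ + b₃| ≤ 2 * κ * m ^ 2) (hs₂ : ‖s₂‖ ≤ M) (hs₁₂ : ‖s₁ - s₂‖ ≤ L * m)
    (hs₃₂ : ‖s₃ - s₂‖ ≤ L * m) (hs : ‖s₁ - 2 * s₂ + s₃‖ ≤ D) :
    ‖b₁ • s₁ - 2 * (b₂ • s₂) + b₃ • s₃‖ ≤ κ * D + 2 * κ * (L + M) * m ^ 2 := by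
  have e : b₁ • s₁ - 2 * (b₂ • s₂) + b₃ • s₃
      = (b₂ • (s₁ - 2 * s₂ + s₃) + (b₁ - 2 * b₂ + b₃) • s₂)
        + ((b₁ - b₂) • (s₁ - s₂) + (b₃ - b₂) • (s₃ - s₂)) := by
    simp only [Complex.real_smul]
    push_cast
    ring
  rw [e]
  have n1 := norm_add_le (b₂ • (s₁ - 2 * s₂ + s₃) + (b₁ - 2 * b₂ + b₃) • s₂)
    ((b₁ - b₂) • (s₁ - s₂) + (b₃ - b₂) • (s₃ - s₂))
  have n2 := norm_add_le (b₂ • (s₁ - 2 * s₂ + s₃)) ((b₁ - 2 * b₂ + b₃) • s₂)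
  have n3 := norm_add_le ((b₁ - b₂) • (s₁ - s₂)) ((b₃ - b₂) • (s₃ - s₂))
  rw [norm_smul, norm_smul, Real.norm_eq_abs, Real.norm_eq_abs] at n2 n3
  have m1 := mul_le_mul hb₂ hs (norm_nonneg _) hκ
  have m2 := mul_le_mul hb hs₂ (norm_nonneg _) (by positivity)
  have m3 := mul_le_mul h₁₂ hs₁₂ (norm_nonneg _) (by positivity)
  have m4 := mul_le_mul h₃₂ hs₃₂ (norm_nonneg _) (by positivity)
  linarith

/-- Three characteristics with a common phase: the second difference solves a linear inequality
whose forcing is quadratic in the shifts, by `DiffBound.second`, the first differences and the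
regularity of the clock. The starting value is quadratic by the second-order expansion at time `0`.
-/
theorem ClockData.exists_second_difference (h : ClockData K b b' β β') (hb : DiffBound K r)
    (h0 : ‖r 0‖ ≤ K) (hc : 0 ≤ c) (hT : 0 ≤ T) (hC : 0 ≤ C) :
    ∃ D, 0 ≤ D ∧ ∀ (ε : ℝ) (w ρ : ℝ × ℝ → ℂ) (W : ℝ → ℝ → ℝ → ℂ), 0 < ε →
      ProfileBound C ε w ρ → IsProfile r b c T ε w ρ W → ∀ t δ : ℝ, t ∈ Icc 0 T →
        t + δ ∈ Icc 0 T → t - δ ∈ Icc 0 T → ∀ y k θ,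
        ‖W (t + δ) (y + k) θ - 2 * W t y θ + W (t - δ) (y - k) θ‖ ≤ D * (|δ| + |k|) ^ 2 := by
  have hK : 0 < K := zero_lt_one.trans_le h.one_le
  obtain ⟨A, hA, hinit⟩ := h.exists_initial_expansion hb hc T hC
  obtain ⟨L, hL, hfirst⟩ := h.exists_first_difference hb h0 hc hT hC
  set G := 1 + 2 * (K * (K * T)) with hG
  have hG0 : 0 ≤ G := by positivity
  set Λ := L * (G + 1) with hΛ
  have hΛ0 : 0 ≤ Λ := by positivity
  -- The four terms bound, in units of `m ^ 2`: the second difference of `w`, the second difference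
  -- of the starting times multiplied by `ρ`, the variation of `ρ` multiplied by two starting times,
  -- and the expansion remainders with weights `1, 2, 1`.
  set E₀ := C + 2 * K * (K * T) * C + 4 * G * C + 16 * A * G ^ 2 with hE₀
  set E₁ := K * (K * Λ ^ 2) + 2 * K * (K * Λ + (K + K * A)) with hE₁
  have hE₀0 : 0 ≤ E₀ := by positivity
  have hE₁0 : 0 ≤ E₁ := by positivity
  refine ⟨(E₀ + E₁ * (K * T)) * Real.exp (K * K * (K * T)), by positivity,
    fun ε w ρ W hε hP hW t δ ht ht₁ ht₃ y k θ => ?_⟩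
  obtain ⟨S, hS, q₁, q₂, q₃, hq₁, hq₂, hq₃, hq0, e₁, e₂, e₃⟩ :=
    h.exists_common_start c ht₁ ht ht₃ (y + k) y (y - k)
  have hS0 := hS.1
  have hbK : ∀ y, b y ≤ K := fun y => (le_abs_self _).trans (h.b_lip.bdd y)
  set Y := y - c * S with hY
  have hY₁ : y + k - c * S = Y + k := by rw [hY]; ring
  have hY₃ : y - k - c * S = Y - k := by rw [hY]; ring
  rw [hY₁] at e₁
  rw [hY₃] at e₃
  set θ0 := θ - S / ε with hθ0
  set m := |δ| + |k| with hm
  have hkm : |k| ≤ m := by rw [hm]; linarith [abs_nonneg δ]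
  have hδm : |δ| ≤ m := by rw [hm]; linarith [abs_nonneg k]
  have hm0 : 0 ≤ m := (abs_nonneg _).trans hkm
  have hk2 : k ^ 2 ≤ m ^ 2 := by rw [← sq_abs k]; exact pow_le_pow_left₀ (abs_nonneg _) hkm 2
  have htrd : ∀ s ∈ Icc 0 S, ∀ k', |k'| ≤ m →
      |travel b c (Y + k') s - travel b c Y s| ≤ K * (K * T) * m := fun s hs k' hk' => by
    have h3 := abs_travel_sub_le (c := c) h.continuous h.b_lip hs.1 (Y + k') Y
    rw [add_sub_cancel_left] at h3
    refine h3.trans (mul_le_mul (mul_le_mul_of_nonneg_left (hs.2.trans hS.2) hK.le) hk'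
      (abs_nonneg _) (by positivity))
  have hkm' : |-k| ≤ m := by rwa [abs_neg]
  -- times of the shifted characteristics stay close
  have hgap : ∀ s ∈ Icc 0 S, ∀ (q q' k' δ' : ℝ), |k'| ≤ m → |δ'| ≤ m →
      q + travel b c (Y + k') S = t + δ' → q' + travel b c Y S = t →
      |q + travel b c (Y + k') s - (q' + travel b c Y s)| ≤ G * m := by
    intro s hs q q' k' δ' hk' hδ' e e'
    have a1 := htrd s hs k' hk'
    have a2 := htrd S ⟨hS0, le_rfl⟩ k' hk'
    have e4 : q + travel b c (Y + k') s - (q' + travel b c Y s)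
        = δ' + (travel b c (Y + k') s - travel b c Y s)
          - (travel b c (Y + k') S - travel b c Y S) := by linarith
    have a3 := abs_sub (δ' + (travel b c (Y + k') s - travel b c Y s))
      (travel b c (Y + k') S - travel b c Y S)
    have a4 := abs_add_le δ' (travel b c (Y + k') s - travel b c Y s)
    rw [e4, hG]
    linarith
  have e₁' : q₁ + travel b c (Y + k) S = t + δ := e₁
  have e₃' : q₃ + travel b c (Y + -k) S = t + -δ := by rw [← sub_eq_add_neg, ← sub_eq_add_neg]; exact e₃
  have hδm' : |-δ| ≤ m := by rwa [abs_neg]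
  have g₁ := fun s hs => hgap s hs q₁ q₂ k δ hkm hδm e₁' e₂
  have g₃ := fun s hs => hgap s hs q₃ q₂ (-k) (-δ) hkm' hδm' e₃' e₂
  simp only [← sub_eq_add_neg] at g₃
  -- One starting time is zero and each outer one is within `G * m` of the middle one.
  have hq : q₁ ≤ 2 * G * m ∧ q₂ ≤ 2 * G * m ∧ q₃ ≤ 2 * G * m := by
    have z : (0 : ℝ) ∈ Icc 0 S := ⟨le_rfl, hS0⟩
    have a1 := abs_le.1 (g₁ 0 z)
    have a3 := abs_le.1 (g₃ 0 z)
    simp only [travel_zero, add_zero] at a1 a3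
    have : 0 ≤ G * m := mul_nonneg hG0 hm0
    rcases hq0 with e | e | e <;> refine ⟨?_, ?_, ?_⟩ <;> linarith [a1.1, a1.2, a3.1, a3.2]
  have htr : ∀ Y, 0 ≤ travel b c Y S := fun Y => by
    have := travel_mono (c := c) h.continuous h.b_pos Y hS.1
    rwa [travel_zero] at this
  have hmem : ∀ q Y t, 0 ≤ q → t ∈ Icc 0 T → q + travel b c Y S = t → ∀ s ∈ Icc 0 S,
      q + travel b c Y s ∈ Icc 0 T := fun q Y t hq ht e s hs => by
    have k1 := travel_mono (c := c) h.continuous h.b_pos Y hs.1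
    have k2 := travel_mono (c := c) h.continuous h.b_pos Y hs.2
    rw [travel_zero] at k1
    exact ⟨by linarith, by linarith [ht.2]⟩
  have hsrc : ∀ t ∈ Icc 0 T, ∀ y θ σ, ‖source r σ (W t y θ)‖ ≤ K + K * A := fun t ht y θ σ => by
    refine ((hb.source σ).norm_le _).trans ?_
    rw [norm_source_zero]
    have := mul_le_mul_of_nonneg_left (hinit ε w ρ W hε hP hW t ht y θ).1 hK.le
    linarith
  have hd₁ := hW.along q₁ (Y + k) θ0 S hq₁ (by rw [e₁]; exact ht₁.2)
  have hd₂ := hW.along q₂ Y θ0 S hq₂ (by rw [e₂]; exact ht.2)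
  have hd₃ := hW.along q₃ (Y - k) θ0 S hq₃ (by rw [e₃]; exact ht₃.2)
  have hgr := norm_le_of_norm_deriv_le (K := K * K) (E := E₁ * m ^ 2)
    (δ := E₀ * m ^ 2) (by positivity) (by positivity)
    (fun s hs => ((hd₁ s hs).sub ((hd₂ s hs).const_mul 2)).add (hd₃ s hs)) ?_ ?_ S ⟨hS.1, le_rfl⟩
  · have eY₁ : Y + k + c * S = y + k := by rw [hY]; ring
    have eY₂ : Y + c * S = y := by rw [hY]; ring
    have eY₃ : Y - k + c * S = y - k := by rw [hY]; ring
    have eθ : θ0 + S / ε = θ := by rw [hθ0]; ring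
    simp only [Pi.add_apply, Pi.sub_apply, e₁, e₂, e₃, eY₁, eY₂, eY₃, eθ] at hgr
    refine hgr.trans ?_
    have hx : Real.exp (K * K * S) ≤ Real.exp (K * K * (K * T)) :=
      Real.exp_le_exp.2 (mul_le_mul_of_nonneg_left hS.2 (by positivity))
    have hE := mul_le_mul_of_nonneg_left hS.2 (show 0 ≤ E₁ * m ^ 2 by positivity)
    calc _ ≤ (E₀ * m ^ 2 + E₁ * m ^ 2 * (K * T)) * Real.exp (K * K * (K * T)) :=
          mul_le_mul (by linarith) hx (Real.exp_pos _).le (by positivity)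
      _ = _ := by ring
  · simp only [Pi.add_apply, Pi.sub_apply, travel_zero, mul_zero, add_zero, zero_div]
    have hrem : ∀ q Y t, 0 ≤ q → t ∈ Icc 0 T → q + travel b c Y S = t → q ≤ 2 * G * m →
        ‖W q Y θ0 - w (Y, θ0) - q • ρ (Y, θ0)‖ ≤ 4 * A * G ^ 2 * m ^ 2 := by
      intro q Y t hq ht e hqm
      have a := (hinit ε w ρ W hε hP hW q ⟨hq, by linarith [htr Y, ht.2]⟩ Y θ0).2.2
      have a2 := mul_le_mul_of_nonneg_left (pow_le_pow_left₀ hq hqm 2) hA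
      refine a.trans (a2.trans (le_of_eq (by ring)))
    have a1 := hrem q₁ (Y + k) _ hq₁ ht₁ e₁ hq.1
    have a2 := hrem q₂ Y _ hq₂ ht e₂ hq.2.1
    have a3 := hrem q₃ (Y - k) _ hq₃ ht₃ e₃ hq.2.2
    have a4 := hP.second Y k θ0
    -- The final times `t + δ, t, t - δ` are in arithmetic progression, so only the second
    -- difference of the travel times remains.
    have a5 : |q₁ - 2 * q₂ + q₃| ≤ 2 * K * (K * T) * m ^ 2 := by
      have x := abs_travel_second_le (c := c) h.continuous h.abs_second_le hS.1 Y k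
      have e : q₁ - 2 * q₂ + q₃
          = -(travel b c (Y + k) S - 2 * travel b c Y S + travel b c (Y - k) S) := by linarith
      rw [e, abs_neg]
      refine x.trans (mul_le_mul ?_ hk2 (sq_nonneg _) (by positivity))
      exact mul_le_mul_of_nonneg_left hS.2 (by positivity)
    have hρ : ∀ k', |k'| ≤ m → ‖ρ (Y + k', θ0) - ρ (Y, θ0)‖ ≤ C * m := fun k' hk' => by
      refine (hP.rate.lip _ _).trans (mul_le_mul_of_nonneg_left ?_ hC)
      simpa [phaseDist] using hk'
    have hρ₁ := hρ k hkm
    have hρ₃ := hρ (-k) hkm'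
    rw [← sub_eq_add_neg] at hρ₃
    have e : W q₁ (Y + k) θ0 - 2 * W q₂ Y θ0 + W q₃ (Y - k) θ0
        = (W q₁ (Y + k) θ0 - w (Y + k, θ0) - q₁ • ρ (Y + k, θ0))
          + (-(2 : ℂ) * (W q₂ Y θ0 - w (Y, θ0) - q₂ • ρ (Y, θ0)))
          + (W q₃ (Y - k) θ0 - w (Y - k, θ0) - q₃ • ρ (Y - k, θ0))
          + (w (Y + k, θ0) - 2 * w (Y, θ0) + w (Y - k, θ0))
          + (q₁ - 2 * q₂ + q₃) • ρ (Y, θ0)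
          + q₁ • (ρ (Y + k, θ0) - ρ (Y, θ0)) + q₃ • (ρ (Y - k, θ0) - ρ (Y, θ0)) := by
      simp only [Complex.real_smul]
      push_cast
      ring
    rw [e]
    refine (norm_add_le_of_le (norm_add_le_of_le (norm_add_le_of_le (norm_add_le_of_le
      (norm_add_le_of_le (norm_add_le_of_le a1 (le_of_eq (norm_mul _ _))) a3) a4)
      (le_of_eq (norm_smul _ _))) (le_of_eq (norm_smul _ _))) (le_of_eq (norm_smul _ _))).trans ?_
    rw [Real.norm_eq_abs, Real.norm_of_nonneg hq₁, Real.norm_of_nonneg hq₃, norm_neg,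
      Complex.norm_ofNat]
    have b1 := mul_le_mul a5 (hP.rate.bdd (Y, θ0)) (norm_nonneg _) (by positivity)
    have b2 := mul_le_mul hq.1 hρ₁ (norm_nonneg _) (by positivity)
    have b3 := mul_le_mul hq.2.2 hρ₃ (norm_nonneg _) (by positivity)
    have b4 := mul_le_mul_of_nonneg_left hk2 hC
    rw [hE₀]
    linarith
  · intro s hs
    simp only [Pi.add_apply, Pi.sub_apply]
    have m₁ := hmem q₁ (Y + k) _ hq₁ ht₁ e₁ s hs
    have m₂ := hmem q₂ Y t hq₂ ht e₂ s hs
    have m₃ := hmem q₃ (Y - k) _ hq₃ ht₃ e₃ s hs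
    have f₁ := hfirst ε w ρ W hε hP hW _ m₁ _ m₂ (Y + k + c * s) (Y + c * s) (θ0 + s / ε)
    have f₃ := hfirst ε w ρ W hε hP hW _ m₃ _ m₂ (Y - k + c * s) (Y + c * s) (θ0 + s / ε)
    have hs₂ := hsrc _ m₂ (Y + c * s) (θ0 + s / ε) (θ0 + s / ε)
    have d₁ : |Y + k + c * s - (Y + c * s)| = |k| := by congr 1; ring
    have d₃ : |Y - k + c * s - (Y + c * s)| = |k| := by rw [← abs_neg k]; congr 1; ring
    rw [d₁] at f₁
    rw [d₃] at f₃
    set u₁ := W (q₁ + travel b c (Y + k) s) (Y + k + c * s) (θ0 + s / ε)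
    set u₂ := W (q₂ + travel b c Y s) (Y + c * s) (θ0 + s / ε)
    set u₃ := W (q₃ + travel b c (Y - k) s) (Y - k + c * s) (θ0 + s / ε)
    have f₁' : ‖u₁ - u₂‖ ≤ Λ * m := by
      refine f₁.trans ?_
      have := mul_le_mul_of_nonneg_left (add_le_add (g₁ s hs) hkm) hL
      rw [hΛ]; linarith
    have f₃' : ‖u₃ - u₂‖ ≤ Λ * m := by
      refine f₃.trans ?_
      have := mul_le_mul_of_nonneg_left (add_le_add (g₃ s hs) hkm) hL
      rw [hΛ]; linarith
    have hsl := hb.source (θ0 + s / ε)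
    have hlip : ∀ u, ‖u - u₂‖ ≤ Λ * m →
        ‖source r (θ0 + s / ε) u - source r (θ0 + s / ε) u₂‖ ≤ K * Λ * m := fun u hu => by
      refine (hsl.lip _ _).trans ?_
      rw [mul_assoc]
      exact mul_le_mul_of_nonneg_left hu hK.le
    have hbl : ∀ x, |x - (Y + c * s)| = |k| → |b x - b (Y + c * s)| ≤ K * m := fun x hx =>
      (h.b_lip.lip _ _).trans (mul_le_mul_of_nonneg_left (by rw [lineDist, hx]; exact hkm) hK.le)
    have hsec : ‖source r (θ0 + s / ε) u₁ - 2 * source r (θ0 + s / ε) u₂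
        + source r (θ0 + s / ε) u₃‖ ≤ K * ‖u₁ - 2 * u₂ + u₃‖ + K * (Λ * m) ^ 2 :=
      (hsl.second u₁ u₂ u₃).trans (add_le_add le_rfl
        (mul_le_mul_of_nonneg_left (pow_le_pow_left₀ (norm_nonneg _) f₁' 2) hK.le))
    have hbsec : |b (Y + k + c * s) - 2 * b (Y + c * s) + b (Y - k + c * s)|
        ≤ 2 * K * m ^ 2 := by
      have x := h.abs_second_le (Y + c * s) k
      have z₁ : Y + c * s + k = Y + k + c * s := by ring
      have z₃ : Y + c * s - k = Y - k + c * s := by ring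
      rw [z₁, z₃] at x
      exact x.trans (mul_le_mul_of_nonneg_left hk2 (by positivity))
    have fin := norm_second_difference_smul_le hK.le hm0 (h.b_lip.bdd (Y + c * s))
      (hbl _ d₁) (hbl _ d₃) hbsec hs₂ (hlip _ f₁') (hlip _ f₃') hsec
    have e : -(b (Y + k + c * s) • source r (θ0 + s / ε) u₁)
          - 2 * -(b (Y + c * s) • source r (θ0 + s / ε) u₂)
          + -(b (Y - k + c * s) • source r (θ0 + s / ε) u₃)
        = -(b (Y + k + c * s) • source r (θ0 + s / ε) u₁
          - 2 * (b (Y + c * s) • source r (θ0 + s / ε) u₂)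
          + b (Y - k + c * s) • source r (θ0 + s / ε) u₃) := by ring
    rw [e, norm_neg]
    refine fin.trans (le_of_eq ?_)
    rw [hE₁]
    ring

end TwoScale

/-! ### From the equation to profiles; consistency of the scheme. -/

namespace TwoScale

open Set Filter Topology

variable {r : ℂ → ℂ} {a : ℝ → ℝ} {α : ℝ → ℂ} {c T ε : ℝ} {V : ℝ → ℝ → ℝ → ℂ}

/-- The chain rule for a classical solution, together with the equation. -/
theorem IsSolution.exists_partials (hV : IsSolution r a α c T ε V) (hT : 0 < T) {t : ℝ}
    (ht : t ∈ Icc 0 T) (x τ : ℝ) :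
    ∃ Vt Vx : ℂ, ∃ Vτ : ℂ, DifferentiableAt ℝ (V t x) τ ∧ deriv (V t x) τ = Vτ ∧
      Vt + (c : ℂ) * Vx + source r τ (V t x τ) = -((a x / ε : ℝ) : ℂ) * Vτ ∧
      ∀ (γ₁ γ₂ γ₃ : ℝ → ℝ) (g₁ g₂ g₃ : ℝ) (I : Set ℝ) (s : ℝ), γ₁ s = t → γ₂ s = x → γ₃ s = τ →
        MapsTo γ₁ I (Icc 0 T) → HasDerivWithinAt γ₁ g₁ I s → HasDerivWithinAt γ₂ g₂ I s →
        HasDerivWithinAt γ₃ g₃ I s →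
        HasDerivWithinAt (fun s => V (γ₁ s) (γ₂ s) (γ₃ s)) (g₁ • Vt + g₂ • Vx + g₃ • Vτ) I s := by
  set F : ℝ × ℝ × ℝ → ℂ := fun p => V p.1 p.2.1 p.2.2 with hF
  have hd : HasFDerivWithinAt F (fderivWithin ℝ F (Icc 0 T ×ˢ univ) (t, x, τ))
      (Icc 0 T ×ˢ univ) (t, x, τ) :=
    (hV.contDiffOn.differentiableOn one_ne_zero (t, x, τ)
      (mk_mem_prod ht (mem_univ (x, τ)))).hasFDerivWithinAt
  set F' := fderivWithin ℝ F (Icc 0 T ×ˢ univ) (t, x, τ) with hF'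
  have hlin : ∀ g₁ g₂ g₃ : ℝ, F' (g₁, g₂, g₃)
      = g₁ • F' (1, 0, 0) + g₂ • F' (0, 1, 0) + g₃ • F' (0, 0, 1) := fun g₁ g₂ g₃ => by
    rw [← map_smul, ← map_smul, ← map_smul, ← map_add, ← map_add]
    simp
  have hchain : ∀ (γ₁ γ₂ γ₃ : ℝ → ℝ) (g₁ g₂ g₃ : ℝ) (I : Set ℝ) (s : ℝ), γ₁ s = t → γ₂ s = x →
      γ₃ s = τ → MapsTo γ₁ I (Icc 0 T) → HasDerivWithinAt γ₁ g₁ I s →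
      HasDerivWithinAt γ₂ g₂ I s → HasDerivWithinAt γ₃ g₃ I s →
      HasDerivWithinAt (fun s => V (γ₁ s) (γ₂ s) (γ₃ s))
        (g₁ • F' (1, 0, 0) + g₂ • F' (0, 1, 0) + g₃ • F' (0, 0, 1)) I s := by
    intro γ₁ γ₂ γ₃ g₁ g₂ g₃ I s e₁ e₂ e₃ hm h₁ h₂ h₃
    rw [← hlin]
    subst e₁ e₂ e₃
    have hmaps : MapsTo (fun u => (γ₁ u, γ₂ u, γ₃ u)) I (Icc 0 T ×ˢ univ) :=
      fun u hu => mk_mem_prod (hm hu) (mem_univ _)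
    exact hd.comp_hasDerivWithinAt s (h₁.prodMk (h₂.prodMk h₃)) hmaps
  have hVt : HasDerivWithinAt (fun s => V s x τ) (F' (1, 0, 0)) (Icc 0 T) t := by
    have := hchain id (fun _ => x) (fun _ => τ) 1 0 0 (Icc 0 T) t rfl rfl rfl (mapsTo_id _)
      (hasDerivWithinAt_id _ _) (hasDerivWithinAt_const _ _ _) (hasDerivWithinAt_const _ _ _)
    simpa using this
  have hVx : HasDerivAt (fun y => V t y τ) (F' (0, 1, 0)) x := by
    have := hchain (fun _ => t) id (fun _ => τ) 0 1 0 univ x rfl rfl rfl (fun _ _ => ht)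
      (hasDerivWithinAt_const _ _ _) (hasDerivWithinAt_id _ _) (hasDerivWithinAt_const _ _ _)
    simpa [hasDerivWithinAt_univ] using this
  have hVτ : HasDerivAt (V t x) (F' (0, 0, 1)) τ := by
    have := hchain (fun _ => t) (fun _ => x) id 0 0 1 univ τ rfl rfl rfl (fun _ _ => ht)
      (hasDerivWithinAt_const _ _ _) (hasDerivWithinAt_const _ _ _) (hasDerivWithinAt_id _ _)
    simpa [hasDerivWithinAt_univ] using this
  refine ⟨F' (1, 0, 0), F' (0, 1, 0), F' (0, 0, 1), hVτ.differentiableAt, hVτ.deriv, ?_, hchain⟩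
  have e := hV.equation t ht x τ
  rw [hVt.derivWithin (uniqueDiffOn_Icc hT t ht), hVx.deriv] at e
  have e2 : deriv (fun θ => V t x θ) τ = F' (0, 0, 1) := hVτ.deriv
  rwa [e2] at e

variable {K C : ℝ} {A B b' : ℝ → ℝ} {β' : ℝ → ℂ}

theorem initialData_eq_initialProfile (hr : Continuous r) (a : ℝ → ℝ) (α : ℝ → ℂ) (B : ℝ → ℝ)
    (ε y θ : ℝ) : initialData r a α ε (B y) θ
      = initialProfile r (fun y => (a (B y))⁻¹) (fun y => α (B y)) ε (y, θ) := by
  rw [initialData_eq hr]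
  simp only [initialProfile, fastPart, Complex.real_smul, div_eq_mul_inv]
  push_cast
  ring

/-- With `ds = a dt` along a characteristic, the chain rule produces the equation divided by `a`,
and only `-b` times the source survives. At time `0` the chain rule is applied to the datum, whose
explicit phase derivative turns the stiff term into the bounded quantities of `initialRate`. -/
theorem IsSolution.isProfile (hV : IsSolution r a α c T ε V) (hT : 0 < T) (hε : 0 < ε)
    (hB : ∀ y, HasDerivAt B (a (B y))⁻¹ y)
    (h : ClockData K (fun y => (a (B y))⁻¹) b' (fun y => α (B y)) β') (hr : Differentiable ℝ r)
    (hr' : Continuous (fderiv ℝ r)) (hb : DiffBound K r) :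
    IsProfile r (fun y => (a (B y))⁻¹) c T ε
      (initialProfile r (fun y => (a (B y))⁻¹) (fun y => α (B y)) ε)
      (initialRate r (fun y => (a (B y))⁻¹) b' (fun y => α (B y)) β' c ε)
      fun t y θ => V t (B y) θ := by
  have hapos : ∀ y, 0 < a (B y) := fun y => inv_pos.1 (h.b_pos y)
  have hw : ∀ y θ, V 0 (B y) θ
      = initialProfile r (fun y => (a (B y))⁻¹) (fun y => α (B y)) ε (y, θ) := fun y θ => by
    rw [hV.initial, initialData_eq_initialProfile hr.continuous]
  have hlin : ∀ Y s : ℝ, HasDerivAt (fun s => Y + c * s) c s := fun Y s => by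
    simpa using ((hasDerivAt_id s).const_mul c).const_add Y
  have hline : ∀ θ s : ℝ, HasDerivAt (fun s => θ + s / ε) (1 / ε) s := fun θ s =>
    ((hasDerivAt_id s).div_const ε).const_add θ
  have hBl : ∀ Y s : ℝ, HasDerivAt (fun s => B (Y + c * s)) ((a (B (Y + c * s)))⁻¹ * c) s :=
    fun Y s => (hB _).comp s (hlin Y s)
  have h0T : (0 : ℝ) ∈ Icc 0 T := ⟨le_rfl, hT.le⟩
  refine ⟨hw, fun Y θ s => ?_, fun q Y θ S hq hqS s hs => ?_⟩
  · set y := Y + c * s with hy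
    set θs := θ + s / ε with hθs
    obtain ⟨Vt, Vx, Vτ, -, e2, -, hch⟩ := hV.exists_partials hT h0T (B y) θs
    have h1 := (hch (fun _ => 0) (fun s => B (Y + c * s)) (fun s => θ + s / ε) 0 _ _ univ s rfl
      rfl rfl (fun _ _ => h0T) (hasDerivWithinAt_const _ _ _) (hBl Y s).hasDerivWithinAt
      (hline θ s).hasDerivWithinAt).hasDerivAt univ_mem
    simp only [hw] at h1
    refine h1.congr_deriv ?_
    have h2 := (hch (fun _ => 0) B (fun _ => θs) 0 _ 0 univ y rfl
      rfl rfl (fun _ _ => h0T) (hasDerivWithinAt_const _ _ _) (hB y).hasDerivWithinAt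
      (hasDerivWithinAt_const _ _ _)).hasDerivAt univ_mem
    simp only [hw] at h2
    -- Uniqueness of the derivative identifies `b • Vx` at time `0` with the explicit derivative of
    -- the profile in `y`.
    have h3 := h2.unique (h.hasDerivAt_initialProfile hr hr' hb ε y θs)
    have h4 : Vτ = _ := e2.symm.trans
      ((funext (hV.initial (B y)) : V 0 (B y) = _) ▸
        (hasDerivAt_initialData hr.continuous a α ε (B y) θs).deriv)
    have hne : (a (B y) : ℂ) ≠ 0 := by exact_mod_cast (hapos y).ne'
    have hεne : (ε : ℂ) ≠ 0 := by exact_mod_cast hε.ne'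
    simp only [initialRate, ← h3, ← hy]
    rw [h4]
    simp only [Complex.real_smul]
    push_cast
    field_simp
    ring
  · have hmono := travel_mono (c := c) h.continuous h.b_pos Y
    have hmaps : MapsTo (fun s => q + travel (fun y => (a (B y))⁻¹) c Y s) (Icc 0 S) (Icc 0 T) := by
      intro u hu
      have k1 := hmono hu.1
      have k2 := hmono hu.2
      rw [travel_zero] at k1
      exact ⟨by linarith, by linarith⟩
    obtain ⟨Vt, Vx, Vτ, -, -, e2, hch⟩ := hV.exists_partials hT (hmaps hs) (B (Y + c * s))
      (θ + s / ε)
    have h1 := hch (fun s => q + travel (fun y => (a (B y))⁻¹) c Y s) (fun s => B (Y + c * s))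
      (fun s => θ + s / ε) _ _ _ (Icc 0 S) s rfl rfl rfl hmaps
      ((hasDerivAt_travel h.continuous Y s).const_add q).hasDerivWithinAt
      (hBl Y s).hasDerivWithinAt (hline θ s).hasDerivWithinAt
    refine h1.congr_deriv ?_
    have hne : (a (B (Y + c * s)) : ℂ) ≠ 0 := by exact_mod_cast (hapos _).ne'
    have hεne : (ε : ℂ) ≠ 0 := by exact_mod_cast hε.ne'
    simp only [Complex.real_smul]
    generalize source r (θ + s / ε) _ = σ at e2 ⊢
    push_cast at e2 ⊢
    generalize (a (B (Y + c * s)) : ℂ) = z at e2 hne ⊢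
    field_simp at e2 ⊢
    linear_combination e2

/-- The first-order expansion of the solution, uniformly in `ε`. -/
theorem norm_taylor_le {D : ℝ} (hBA : ∀ x, B (A x) = x)
    (hB : ∀ y, HasDerivAt B (a (B y))⁻¹ y)
    (hsec : ∀ t δ : ℝ, t ∈ Icc 0 T → t + δ ∈ Icc 0 T → t - δ ∈ Icc 0 T → ∀ y k θ,
      ‖V (t + δ) (B (y + k)) θ - 2 * V t (B y) θ + V (t - δ) (B (y - k)) θ‖
        ≤ D * (|δ| + |k|) ^ 2)
    {t δ : ℝ} (ht : t ∈ Icc 0 T) (hδ : 0 ≤ δ) (htδ : t - δ ∈ Icc 0 T) (x x' τ : ℝ) {Vt Vx Vτ : ℂ}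
    (hch : ∀ (γ₁ γ₂ γ₃ : ℝ → ℝ) (g₁ g₂ g₃ : ℝ) (I : Set ℝ) (s : ℝ), γ₁ s = t → γ₂ s = x →
        γ₃ s = τ → MapsTo γ₁ I (Icc 0 T) → HasDerivWithinAt γ₁ g₁ I s →
        HasDerivWithinAt γ₂ g₂ I s → HasDerivWithinAt γ₃ g₃ I s →
        HasDerivWithinAt (fun s => V (γ₁ s) (γ₂ s) (γ₃ s)) (g₁ • Vt + g₂ • Vx + g₃ • Vτ) I s) :
    ‖V (t - δ) x' τ - V t x τ - ((-δ) • Vt + ((a x)⁻¹ * (A x' - A x)) • Vx)‖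
      ≤ D * (δ + |A x' - A x|) ^ 2 / 2 := by
  set k := A x' - A x with hk
  set y := A x with hy
  have hBy : B y = x := hBA x
  have hmaps : MapsTo (fun μ => t - μ * δ) (Icc 0 1) (Icc 0 T) := fun μ hμ => by
    have h1 : μ * δ ≤ δ := mul_le_of_le_one_left hδ hμ.2
    have h2 := mul_nonneg hμ.1 hδ
    exact ⟨by linarith [htδ.1], by linarith [ht.2]⟩
  -- The path is straight in `(t, y)`, not in `(t, x)`, since second differences are controlled in
  -- `y`.
  have hd := hch (fun μ => t - μ * δ) (fun μ => B (y + μ * k)) (fun _ => τ) (-δ)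
    ((a x)⁻¹ * k) 0 (Icc 0 1) 0 (by simp) (by simp [hBy]) rfl hmaps
    (by simpa using (((hasDerivAt_id (0 : ℝ)).mul_const δ).const_sub t).hasDerivWithinAt)
    (by
      have h1 : HasDerivAt (fun μ : ℝ => y + μ * k) k 0 := by
        simpa using ((hasDerivAt_id (0 : ℝ)).mul_const k).const_add y
      have h2 : HasDerivAt B (a x)⁻¹ (y + 0 * k) := by
        have := hB y
        rw [hBy] at this
        simpa using this
      exact (h2.comp (0 : ℝ) h1).hasDerivWithinAt) (hasDerivWithinAt_const _ _ _)
  rw [zero_smul, add_zero] at hd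
  have := norm_sub_sub_deriv_le (C := D * (δ + |k|) ^ 2) hd fun μ hμ hμ2 => by
    have hm1 := hmaps (show μ ∈ Icc 0 1 from ⟨hμ, by linarith⟩)
    have hm2 := hmaps (show 2 * μ ∈ Icc 0 1 from ⟨by linarith, hμ2⟩)
    have e1 : t - μ * δ + -(μ * δ) = t - 2 * μ * δ := by ring
    have e2 : t - μ * δ - -(μ * δ) = t := by ring
    have e3 : y + μ * k + μ * k = y + 2 * μ * k := by ring
    have e4 : y + μ * k - μ * k = y := by ring
    -- Centred at parameter `μ`, with outer points at parameters `2 * μ` and `0`.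
    have h1 := hsec (t - μ * δ) (-(μ * δ)) hm1 (by rw [e1]; exact hm2) (by rw [e2]; exact ht)
      (y + μ * k) (μ * k) τ
    rw [e1, e2, e3, e4] at h1
    simp only [zero_mul, sub_zero, add_zero]
    refine h1.trans (le_of_eq ?_)
    rw [abs_neg, abs_mul, abs_mul, abs_of_nonneg hμ, abs_of_nonneg hδ]
    ring
  simp only [one_mul, zero_mul, sub_zero, add_zero, hBy] at this
  have e : y + k = A x' := by rw [hk]; ring
  rwa [e, hBA] at this

theorem abs_sub_add_mul_le (hK : 0 ≤ K) (hA : ∀ x, HasDerivAt A (a x) x)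
    (ha : BddLip lineDist K a) (x : ℝ) {d : ℝ} (hd : 0 ≤ d) :
    |A (x - d) - A x + a x * d| ≤ K * d ^ 2 ∧ |A (x - d) - A x| ≤ K * d := by
  constructor
  · have h := (convex_Icc (x - d) x).norm_image_sub_le_of_norm_hasDerivWithin_le
      (f := fun z => A z - a x * z) (f' := fun z => a z - a x * 1) (C := K * d)
      (fun z _ => ((hA z).sub ((hasDerivAt_id z).const_mul (a x))).hasDerivWithinAt)
      (fun z hz => ?_) (right_mem_Icc.2 (by linarith)) (left_mem_Icc.2 (by linarith))
    · have e : A (x - d) - a x * (x - d) - (A x - a x * x) = A (x - d) - A x + a x * d := by ring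
      rw [e, Real.norm_eq_abs, Real.norm_eq_abs] at h
      have e2 : |x - d - x| = d := by rw [sub_sub_cancel_left, abs_neg, abs_of_nonneg hd]
      rw [e2] at h
      linarith
    · rw [mul_one]
      refine (ha.lip z x).trans (mul_le_mul_of_nonneg_left ?_ hK)
      rw [lineDist, abs_le]
      constructor <;> linarith [hz.1, hz.2]
  · have h := convex_univ.norm_image_sub_le_of_norm_hasDerivWithin_le
      (f := A) (C := K) (fun z _ => (hA z).hasDerivWithinAt) (fun z _ => ha.bdd z)
      (mem_univ x) (mem_univ (x - d))
    rwa [Real.norm_eq_abs, Real.norm_eq_abs, sub_sub_cancel_left, abs_neg, abs_of_nonneg hd] at h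

/-- The truncation error of the scheme is of first order, uniformly in `ε`. -/
theorem norm_truncation_le {D L : ℝ} (hK : 0 ≤ K) (hT : 0 < T) (hc : 0 ≤ c)
    (hAd : ∀ x, HasDerivAt A (a x) x) (hB : ∀ y, HasDerivAt B (a (B y))⁻¹ y)
    (hBA : ∀ x, B (A x) = x) (ha : BddLip lineDist K a)
    (hapos : ∀ x, 0 < a x) (hainv : ∀ x, (a x)⁻¹ ≤ K) (hb : DiffBound K r)
    (hD : 0 ≤ D) (hL : 0 ≤ L) (hV : IsSolution r a α c T ε V)
    (hfirst : ∀ t₁ ∈ Icc 0 T, ∀ t₂ ∈ Icc 0 T, ∀ y₁ y₂ θ,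
      ‖V t₁ (B y₁) θ - V t₂ (B y₂) θ‖ ≤ L * (|t₁ - t₂| + |y₁ - y₂|))
    (hsec : ∀ t δ : ℝ, t ∈ Icc 0 T → t + δ ∈ Icc 0 T → t - δ ∈ Icc 0 T → ∀ y k θ,
      ‖V (t + δ) (B (y + k)) θ - 2 * V t (B y) θ + V (t - δ) (B (y - k)) θ‖
        ≤ D * (|δ| + |k|) ^ 2)
    {t Δt Δx : ℝ} (hΔt : 0 < Δt) (hΔx : 0 < Δx) (hcfl : c * Δt / Δx ≤ 1) (ht : t ∈ Icc 0 T)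
    (ht' : t - Δt ∈ Icc 0 T) (x τ : ℝ) :
    ‖V t x τ + ((Δt * (a x / ε) : ℝ) : ℂ) * deriv (V t x) τ
        - explicitStep r c Δt Δx (V (t - Δt) x) (V (t - Δt) (x - Δx)) τ‖
      ≤ (4 * D + 2 * K ^ 2 * c * D + K ^ 3 * c * L + K * L) * (Δt * (Δt + Δx)) := by
  obtain ⟨Vt, Vx, Vτ, -, e1, e2, hch⟩ := hV.exists_partials hT ht x τ
  set lam := c * Δt / Δx with hlam
  have hlam0 : 0 ≤ lam := by positivity
  have hlx : lam * Δx = c * Δt := by rw [hlam]; field_simp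
  obtain ⟨k1, k2⟩ := abs_sub_add_mul_le hK hAd ha x hΔx.le
  have t1 := norm_taylor_le hBA hB hsec ht hΔt.le ht' x x τ hch
  have t2 := norm_taylor_le hBA hB hsec ht hΔt.le ht' x (x - Δx) τ hch
  set k := A (x - Δx) - A x with hk
  simp only [sub_self, mul_zero, zero_smul, add_zero, abs_zero] at t1
  set V0 := V t x τ
  set V1 := V (t - Δt) x τ with hV1
  set V2 := V (t - Δt) (x - Δx) τ with hV2
  have hVx : ‖Vx‖ ≤ L * K := by
    have hdx : HasDerivAt (fun y => V t y τ) Vx x := by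
      have := (hch (fun _ => t) id (fun _ => τ) 0 1 0 univ x rfl rfl rfl (fun _ _ => ht)
        (hasDerivWithinAt_const _ _ _) (hasDerivWithinAt_id _ _)
        (hasDerivWithinAt_const _ _ _)).hasDerivAt univ_mem
      simpa using this
    refine hdx.le_of_lip' (by positivity) (Eventually.of_forall fun z => ?_)
    have := hfirst t ht t ht (A z) (A x) τ
    rw [hBA, hBA, sub_self, abs_zero, zero_add] at this
    refine this.trans ?_
    have h3 := convex_univ.norm_image_sub_le_of_norm_hasDerivWithin_le
      (f := A) (C := K) (fun z _ => (hAd z).hasDerivWithinAt) (fun z _ => ha.bdd z)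
      (mem_univ x) (mem_univ z)
    rw [mul_assoc]
    exact mul_le_mul_of_nonneg_left h3 hL
  have hs : ‖source r τ V1 - source r τ V0‖ ≤ K * (L * Δt) := by
    refine ((hb.source τ).lip _ _).trans (mul_le_mul_of_nonneg_left ?_ hK)
    have := hfirst _ ht' t ht (A x) (A x) τ
    rwa [hBA, sub_self, abs_zero, add_zero, sub_sub_cancel_left, abs_neg,
      abs_of_pos hΔt] at this
  have hbk : |(a x)⁻¹ * k + Δx| ≤ K * (K * Δx ^ 2) := by
    have e : (a x)⁻¹ * k + Δx = (a x)⁻¹ * (k + a x * Δx) := by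
      have := (hapos x).ne'
      field_simp
    rw [e, abs_mul, abs_of_pos (inv_pos.2 (hapos x))]
    exact mul_le_mul (hainv x) k1 (abs_nonneg _) hK
  have hΔxne : (Δx : ℂ) ≠ 0 := by exact_mod_cast hΔx.ne'
  -- The expansion is about the new level, where the equation eliminates `Vτ` exactly. Since `lam *
  -- Δx = c * Δt`, the first-order terms cancel, leaving the Taylor remainders, the curvature of
  -- `A`, and the time lag of the source.
  have e : V0 + ((Δt * (a x / ε) : ℝ) : ℂ) * deriv (V t x) τ
        - explicitStep r c Δt Δx (V (t - Δt) x) (V (t - Δt) (x - Δx)) τ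
      = -(V1 - V0 - (-Δt) • Vt)
        + lam • ((V1 - V0 - (-Δt) • Vt) - (V2 - V0 - ((-Δt) • Vt + ((a x)⁻¹ * k) • Vx))
          - ((a x)⁻¹ * k + Δx) • Vx)
        + Δt • (source r τ V1 - source r τ V0) := by
    have e3 : ((Δt * (a x / ε) : ℝ) : ℂ) * deriv (V t x) τ
        = -(Δt : ℂ) * (Vt + (c : ℂ) * Vx + source r τ V0) := by
      rw [e1, e2]; push_cast; ring
    have e4 : (lam : ℂ) * (Δx : ℂ) = (c : ℂ) * (Δt : ℂ) := by exact_mod_cast hlx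
    have e5 : (Δt : ℂ) * ((c : ℂ) * ((V1 - V2) / (Δx : ℂ))) = (lam : ℂ) * (V1 - V2) := by
      rw [hlam]; push_cast; field_simp
    rw [e3, explicitStep, ← hV1, ← hV2]
    simp only [Complex.real_smul]
    push_cast
    linear_combination Vx * e4 + e5
  rw [e]
  have n1 := norm_add_le_of_le (norm_add_le (-(V1 - V0 - (-Δt) • Vt))
    (lam • ((V1 - V0 - (-Δt) • Vt) - (V2 - V0 - ((-Δt) • Vt + ((a x)⁻¹ * k) • Vx))
          - ((a x)⁻¹ * k + Δx) • Vx))) (le_of_eq (norm_smul Δt (source r τ V1 - source r τ V0)))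
  refine n1.trans ?_
  rw [norm_neg, norm_smul, Real.norm_of_nonneg hlam0, Real.norm_of_nonneg hΔt.le]
  have n2 := norm_sub_le_of_le (norm_sub_le_of_le t1 t2)
    (le_of_eq (norm_smul ((a x)⁻¹ * k + Δx) Vx))
  rw [Real.norm_eq_abs] at n2
  have n3 := mul_le_mul hbk hVx (norm_nonneg _) (by positivity)
  have n4 : D * (Δt + |k|) ^ 2 / 2 ≤ D * (Δt ^ 2 + K ^ 2 * Δx ^ 2) := by
    have h1 : (Δt + |k|) ^ 2 ≤ (Δt + K * Δx) ^ 2 :=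
      pow_le_pow_left₀ (by positivity) (by linarith) 2
    have h2 : (Δt + K * Δx) ^ 2 ≤ 2 * (Δt ^ 2 + K ^ 2 * Δx ^ 2) := by
      nlinarith [sq_nonneg (Δt - K * Δx)]
    have := mul_le_mul_of_nonneg_left (h1.trans h2) hD
    linarith
  have n5 := mul_le_mul_of_nonneg_left (n2.trans (add_le_add (add_le_add le_rfl n4) n3)) hlam0
  have n6 := mul_le_mul_of_nonneg_left hs hΔt.le
  -- Every term must keep a factor `Δt`: on `Δt ^ 2` the bound `lam ≤ 1` suffices, while on `Δx ^ 2`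
  -- the identity `lam * Δx = c * Δt` provides it.
  have l1 : lam * (D * Δt ^ 2) ≤ D * Δt ^ 2 := mul_le_of_le_one_left (by positivity) hcfl
  have l2 : lam * Δx ^ 2 = c * Δt * Δx := by rw [pow_two, ← mul_assoc, hlx]
  have l3 : lam * (D * (Δt ^ 2 + K ^ 2 * Δx ^ 2)) = lam * (D * Δt ^ 2)
      + D * K ^ 2 * (c * Δt * Δx) := by rw [← l2]; ring
  have l4 : lam * (K * (K * Δx ^ 2) * (L * K)) = K ^ 3 * L * (c * Δt * Δx) := by rw [← l2]; ring
  have p1 : 0 ≤ D * Δt ^ 2 := by positivity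
  have p2 : 0 ≤ D * (Δt * Δx) := by positivity
  have p3 : 0 ≤ K ^ 2 * c * D * (Δt * Δx) := by positivity
  have p4 : 0 ≤ K ^ 2 * c * D * (Δt * Δt) := by positivity
  have p5 : 0 ≤ K ^ 3 * c * L * (Δt * Δt) := by positivity
  have p6 : 0 ≤ K * L * (Δt * Δx) := by positivity
  linarith

end TwoScale

/-! ### Stability and convergence. -/

namespace TwoScale

open Set Filter Topology

variable {r : ℂ → ℂ} {a : ℝ → ℝ} {α : ℝ → ℂ} {c T ε K : ℝ} {V : ℝ → ℝ → ℝ → ℂ}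

/-- Stability of the explicit part of the scheme under the CFL condition. -/
theorem norm_explicitStep_sub_le (hb : DiffBound K r) {Δt Δx M : ℝ} (hc : 0 ≤ c) (hΔt : 0 < Δt)
    (hΔx : 0 < Δx) (hcfl : c * Δt / Δx ≤ 1) {u um v vm : ℝ → ℂ} {τ : ℝ}
    (h : ‖u τ - v τ‖ ≤ M) (hm : ‖um τ - vm τ‖ ≤ M) :
    ‖explicitStep r c Δt Δx u um τ - explicitStep r c Δt Δx v vm τ‖ ≤ (1 + K * Δt) * M := by
  have hK : 0 ≤ K := by simpa using (norm_nonneg _).trans (hb.lip 1 0)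
  set lam := c * Δt / Δx with hlam
  have hlam0 : 0 ≤ lam := by positivity
  have hΔxne : (Δx : ℂ) ≠ 0 := by exact_mod_cast hΔx.ne'
  -- Under the CFL condition the upwind transport is a convex combination, with weights `1 - lam`
  -- and `lam`.
  have e : explicitStep r c Δt Δx u um τ - explicitStep r c Δt Δx v vm τ
      = (1 - lam) • (u τ - v τ) + lam • (um τ - vm τ)
        - Δt • (source r τ (u τ) - source r τ (v τ)) := by
    simp only [explicitStep, Complex.real_smul, hlam]
    push_cast
    field_simp
    ring
  rw [e]
  refine (norm_sub_le_of_le (norm_add_le_of_le (le_of_eq (norm_smul _ _))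
    (le_of_eq (norm_smul _ _))) (le_of_eq (norm_smul _ _))).trans ?_
  rw [Real.norm_of_nonneg hlam0, Real.norm_of_nonneg (sub_nonneg.2 hcfl),
    Real.norm_of_nonneg hΔt.le]
  have h1 := mul_le_mul_of_nonneg_left h (sub_nonneg.2 hcfl)
  have h2 := mul_le_mul_of_nonneg_left hm hlam0
  have h3 := mul_le_mul_of_nonneg_left (((hb.source τ).lip (u τ) (v τ)).trans
    (mul_le_mul_of_nonneg_left h hK)) hΔt.le
  linarith

/-- Convergence from consistency. -/
theorem norm_error_le (hb : DiffBound K r) (hT : 0 < T) (hc : 0 ≤ c)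
    (hV : IsSolution r a α c T ε V) {D Δt : ℝ} {N M : ℕ} (hD : 0 ≤ D) (hM : 0 < M)
    (hΔt : 0 < Δt) (hN : N * Δt = T) (hcfl : c * Δt / (1 / M) ≤ 1)
    (hcons : ∀ t ∈ Icc 0 T, t - Δt ∈ Icc 0 T → ∀ x τ,
      ‖V t x τ + ((Δt * (a x / ε) : ℝ) : ℂ) * deriv (V t x) τ
        - explicitStep r c Δt (1 / M) (V (t - Δt) x) (V (t - Δt) (x - 1 / M)) τ‖ ≤ D * Δt)
    {v : ℕ → ℤ → ℝ → ℂ} (hv : IsSchemeSolution r a α c ε Δt M v) :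
    ∀ n : ℕ, n ≤ N → ∀ (j : ℤ) (τ : ℝ), ‖V (n * Δt) (j * (1 / M)) τ - v n j τ‖
      ≤ D * (n * Δt) * Real.exp (K * (n * Δt)) := by
  have hK : 0 ≤ K := by simpa using (norm_nonneg _).trans (hb.lip 1 0)
  have hΔx : (0 : ℝ) < 1 / M := by positivity
  intro n
  induction n with
  | zero =>
    intro _ j τ
    rw [Nat.cast_zero, zero_mul, hV.initial, hv.initial, sub_self, norm_zero]
    simp
  | succ n ih =>
    intro hn j τ
    have hmem : ∀ m : ℕ, m ≤ N → (m : ℝ) * Δt ∈ Icc 0 T := fun m hm => by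
      refine ⟨by positivity, ?_⟩
      rw [← hN]
      exact mul_le_mul_of_nonneg_right (by exact_mod_cast hm) hΔt.le
    have ht' := hmem n (by omega)
    have ht := hmem (n + 1) hn
    set t : ℝ := ((n + 1 : ℕ) : ℝ) * Δt with ht_def
    have e1 : t - Δt = n * Δt := by rw [ht_def]; push_cast; ring
    set x : ℝ := j * (1 / M) with hx
    have e2 : x - 1 / M = ((j - 1 : ℤ) : ℝ) * (1 / M) := by rw [hx]; push_cast; ring
    have hdV : Differentiable ℝ (V t x) := fun τ => by
      obtain ⟨_, _, _, h, -⟩ := hV.exists_partials hT ht x τ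
      exact h
    have hdv := (hv.contDiff (n + 1) j).differentiable one_ne_zero
    -- The error solves a resolvent equation whose right-hand side is the truncation error plus the
    -- difference of the explicit updates; the maximum principle discards the stiff term.
    refine norm_le_of_resolvent (u := V t x - v (n + 1) j) (κ := Δt * (a x / ε))
      (F := fun τ => (V t x τ + ((Δt * (a x / ε) : ℝ) : ℂ) * deriv (V t x) τ
          - explicitStep r c Δt (1 / M) (V (t - Δt) x) (V (t - Δt) (x - 1 / M)) τ)
        + (explicitStep r c Δt (1 / M) (V (t - Δt) x) (V (t - Δt) (x - 1 / M)) τ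
          - explicitStep r c Δt (1 / M) (v n j) (v n (j - 1)) τ)) Real.two_pi_pos
      (hdV.sub hdv) (Function.Periodic.sub (fun τ => hV.periodic_tau t ht x τ)
        (hv.periodic_tau (n + 1) j)) (fun s => ?_) (fun s => ?_) τ
    · have h1 := (step_iff_resolvent hΔt _ _ _).1 (hv.step n j s)
      rw [deriv_sub (hdV s) (hdv s), Pi.sub_apply]
      rw [← hx] at h1
      linear_combination -h1
    · have hs := norm_explicitStep_sub_le hb hc hΔt hΔx hcfl (τ := s)
        (M := D * (n * Δt) * Real.exp (K * (n * Δt)))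
        (u := V (t - Δt) x) (v := v n j) (um := V (t - Δt) (x - 1 / M)) (vm := v n (j - 1))
        (by rw [e1]; exact ih (by omega) j s) (by rw [e1, e2]; exact ih (by omega) (j - 1) s)
      refine (norm_add_le_of_le (hcons t ht (by rw [e1]; exact ht') x s) hs).trans ?_
      have hexp : Real.exp (K * t) = Real.exp (K * Δt) * Real.exp (K * (n * Δt)) := by
        rw [← Real.exp_add]; congr 1; rw [ht_def]; push_cast; ring
      have h1 : 1 + K * Δt ≤ Real.exp (K * Δt) := by
        linarith [Real.add_one_le_exp (K * Δt)]
      have h2 : 1 ≤ Real.exp (K * t) := Real.one_le_exp (mul_nonneg hK ht.1)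
      have h3 := mul_le_mul_of_nonneg_right h1
        (show 0 ≤ D * (n * Δt) * Real.exp (K * (n * Δt)) by positivity)
      have h4 := mul_le_mul_of_nonneg_left h2 (show 0 ≤ D * Δt by positivity)
      have e3 : t = n * Δt + Δt := by linarith
      calc _ ≤ D * Δt * Real.exp (K * t)
            + Real.exp (K * Δt) * (D * (n * Δt) * Real.exp (K * (n * Δt))) := by linarith
        _ = D * (n * Δt + Δt) * Real.exp (K * t) := by rw [hexp]; ring
        _ = _ := by rw [← e3]

end TwoScale

/-! ### The main theorem. -/

theorem theorem2p2
    (r : ℂ → ℂ) (hr : Differentiable ℝ r) (hr' : Differentiable ℝ (fderiv ℝ r))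
    (hr_bdd : ∃ K : ℝ, ∀ z, ‖fderiv ℝ r z‖ ≤ K)
    (hr'_bdd : ∃ K : ℝ, ∀ z, ‖fderiv ℝ (fderiv ℝ r) z‖ ≤ K)
    (a : ℝ → ℝ) (ha : ContDiff ℝ 2 a) (ha_per : Function.Periodic a 1)
    (a₀ : ℝ) (ha₀ : 0 < a₀) (ha_pos : ∀ x, a₀ ≤ a x)
    (α : ℝ → ℂ) (hα : ContDiff ℝ 2 α) (hα_per : Function.Periodic α 1)
    (c : ℝ) (hc : 0 ≤ c) (T : ℝ) (hT : 0 < T) :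
    -- the scheme is well defined
    (∀ ε : ℝ, 0 < ε → ε ≤ 1 → ∀ Δt : ℝ, 0 < Δt → ∀ M : ℕ, 0 < M →
      ∃! v : ℕ → ℤ → ℝ → ℂ, TwoScale.IsSchemeSolution r a α c ε Δt M v) ∧
    -- first-order error bound, uniform in `ε`
    ∃ C : ℝ, 0 < C ∧
      ∀ (N M : ℕ) (Δt Δx : ℝ), 0 < N → 0 < M → N * Δt = T → Δx = 1 / M →
        c * Δt / Δx < 1 →
        ∀ ε : ℝ, 0 < ε → ε ≤ 1 →
        ∀ V : ℝ → ℝ → ℝ → ℂ, TwoScale.IsSolution r a α c T ε V →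
        ∀ v : ℕ → ℤ → ℝ → ℂ, TwoScale.IsSchemeSolution r a α c ε Δt M v →
        ∀ n : ℕ, n ≤ N → ∀ j : ℤ, ∀ τ : ℝ,
          ‖V (n * Δt) (j * Δx) τ - v n j τ‖ ≤ C * (Δt + Δx) := by
  have hapos : ∀ x, 0 < a x := fun x => ha₀.trans_le (ha_pos x)
  refine ⟨fun ε hε _ Δt hΔt M hM => ⟨_, TwoScale.isSchemeSolution_schemeIterate hr.continuous
    hapos ha_per hα_per c hε hΔt hM, fun w hw => hw.unique hΔt
    (TwoScale.isSchemeSolution_schemeIterate hr.continuous hapos ha_per hα_per c hε hΔt hM)⟩, ?_⟩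
  obtain ⟨K₁, hK₁⟩ := hr_bdd
  obtain ⟨K₂, hK₂⟩ := hr'_bdd
  obtain ⟨K₃, A, B, b', β', hAd, hB, hBA, -, haK, hclock⟩ :=
    TwoScale.exists_clock ha ha_per ha₀ ha_pos hα hα_per
  -- A single `K` dominates all the data and is fixed before `ε` and the step sizes.
  obtain ⟨K, hk₁, hk₂, hk₃, hk₀⟩ := ((Filter.eventually_ge_atTop K₁).and
    ((Filter.eventually_ge_atTop K₂).and ((Filter.eventually_ge_atTop K₃).and
      (Filter.eventually_ge_atTop ‖r 0‖)))).exists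
  have h := hclock.mono hk₃
  have haK := haK.mono hk₃ TwoScale.lineDist_nonneg
  have hb : TwoScale.DiffBound K r := TwoScale.DiffBound.of_fderiv hr hr'
    (fun z => (hK₁ z).trans hk₁) fun z => (hK₂ z).trans hk₂
  have hK : 0 ≤ K := zero_le_one.trans h.one_le
  have hainv : ∀ x, (a x)⁻¹ ≤ K := fun x => by
    have := (le_abs_self _).trans (h.b_lip.bdd (A x))
    rwa [hBA] at this
  obtain ⟨C, hC⟩ := h.exists_profileBound hr hr'.continuous hb hk₀ c
  have hC0 : 0 ≤ C := (norm_nonneg _).trans ((hC 1 one_pos le_rfl).bdd 0)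
  obtain ⟨L, hL, hfirst⟩ := h.exists_first_difference hb hk₀ hc hT.le hC0
  obtain ⟨D, hD, hsec⟩ := h.exists_second_difference hb hk₀ hc hT.le hC0
  set D' := 4 * D + 2 * K ^ 2 * c * D + K ^ 3 * c * L + K * L with hD'
  have hD'0 : 0 ≤ D' := by positivity
  -- The summand `1` only makes the constant strictly positive.
  refine ⟨D' * T * Real.exp (K * T) + 1, by positivity, ?_⟩
  intro N M Δt Δx hN hM hNT hΔx hcfl ε hε hε1 V hV v hv n hn j τ
  subst hΔx
  have hN' : (0 : ℝ) < N := by exact_mod_cast hN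
  have hΔt : 0 < Δt := by
    rw [← hNT] at hT
    exact pos_of_mul_pos_right hT hN'.le
  have hΔx : (0 : ℝ) < 1 / M := by positivity
  have hP := hV.isProfile hT hε hB h hr hr'.continuous hb
  have herr := TwoScale.norm_error_le hb hT hc hV (D := D' * (Δt + 1 / M)) (by positivity) hM hΔt
    hNT hcfl.le (fun t ht ht' x τ => (TwoScale.norm_truncation_le hK hT hc hAd hB hBA haK hapos
      hainv hb hD hL hV (hfirst ε _ _ _ hε (hC ε hε hε1) hP)
      (hsec ε _ _ _ hε (hC ε hε hε1) hP) hΔt hΔx hcfl.le ht ht' x τ).trans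
      (le_of_eq (by rw [hD']; ring))) hv n hn j τ
  refine herr.trans ?_
  have hnT : (n : ℝ) * Δt ≤ T := by
    rw [← hNT]
    exact mul_le_mul_of_nonneg_right (by exact_mod_cast hn) hΔt.le
  have h1 : Real.exp (K * (n * Δt)) ≤ Real.exp (K * T) :=
    Real.exp_le_exp.2 (mul_le_mul_of_nonneg_left hnT hK)
  have h2 : D' * (Δt + 1 / M) * (n * Δt) * Real.exp (K * (n * Δt))
      ≤ D' * (Δt + 1 / M) * T * Real.exp (K * T) :=
    mul_le_mul (mul_le_mul_of_nonneg_left hnT (by positivity)) h1 (Real.exp_pos _).le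
      (by positivity)
  linarith
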